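/- **Lemma (generalized Roth lemma).** Let $m,n\ge 1$ be integers and let $d=(d_1,\dots,d_m)$ be a tuple of positive integers. For a number field $K$ let $h$ denote the absolute logarithmic Weil height: $h(x)=\sum_{v}\log\max_i|x_i|_v$ for a nonzero vector $x$ over $K$, where $v$ runs over the places of $K$ and the absolute values are normalized by $|\alpha|_{\mathfrak p}=N(\mathfrak p)^{-\operatorname{ord}_{\mathfrak p}(\alpha)/[K:\mathbb Q]}$ at primes $\mathfrak p$ and by $|\alpha|_v=|\tau(\alpha)|^{d_v/[K:\mathbb Q]}$ at the archimedean place of an embedding $\tau$ ($d_v=1$ if $\tau$ is real, $d_v=2$ if $\tau$ is complex). The height of a nonzero polynomial or linear form is the height of its vector of coefficients. Let $\mathbf X_h=(X_{h,0},\dots,X_{h,n})$ for $h=1,\dots,m$ be blocks of variables. Let $P\neq 0$ be a polynomial in $\mathbf X_1,\dots,\mathbf X_m$ that is multihomogeneous of multidegree $d$, i.e. homogeneous of degree $d_h$ in $\mathbf X_h$ for each $h$, and let $M_1,\dots,M_m$ be nonzero linear forms in $n+1$ variables, where the coefficients of $P$ and of the $M_j$ lie in a number field $K\subset\overline{\mathbb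 Q}$. For real $t\ge 0$ let $\mathcal I(t;d;M)$ be the ideal of $\overline{\mathbb Q}[\mathbf X_1,\dots,\mathbf X_m]$ generated by all products $M_1(\mathbf X_1)^{j_1}\cdots M_m(\mathbf X_m)^{j_m}$ with integers $j_h\ge 0$ and $\frac{j_1}{d_1}+\dots+\frac{j_m}{d_m}\ge t$, and put $$\operatorname{Ind}(P;d;M):=\sup\{t\ge 0 \mid P\in\mathcal I(t;d;M)\}.$$ Let $\sigma\in(0,1/2]$ and suppose that 1. $d_{j+1}/d_j\le\sigma$ for $j=1,\dots,m-1$; 2. $\min_{1\le j\le m} d_j\,h(M_j)\ \ge\ n\,\sigma^{-1}\bigl(h(P)+4m\,d_1\bigr)$. Then $$\operatorname{Ind}(P;d;M)\le 2m\,\sigma^{1/2^{m-1}}.$$ -/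

import Mathlib

namespace GenRoth

open MvPolynomial

/-- The absolute logarithmic Weil height of the projective point with homogeneous coordinates
`x`, i.e. `∑_v log max_i |x_i|_v` over the places `v` of the number field `K`, with
`|x|_v = ‖x‖_v ^ (1 / [K : ℚ])`. Mathlib's `Height.logHeight` is the height relative to `K`
(finite places normalized by the ideal norm, complex places counted twice), so it is divided
by `[K : ℚ]`. -/
noncomputable def absHeight {K : Type*} [Field K] [NumberField K] {ι : Type*} (x : ι → K) : ℝ :=
  Height.logHeight x / (Module.finrank ℚ K : ℝ)

/-- The absolute logarithmic height of a polynomial: the height of its vector of coefficients. -/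
noncomputable def polyHeight {K : Type*} [Field K] [NumberField K] {τ : Type*}
    (P : MvPolynomial τ K) : ℝ :=
  absHeight (fun s : P.support => P.coeff s.1)

/-- `P` is multihomogeneous of multidegree `d` in the `m` blocks
`X_h = (X_{h,0}, …, X_{h,n})` of variables. -/
def IsMultihomogeneous {F : Type*} [CommSemiring F] {m n : ℕ} (d : Fin m → ℕ)
    (P : MvPolynomial (Fin m × Fin (n + 1)) F) : Prop :=
  ∀ s ∈ P.support, ∀ h : Fin m, ∑ i : Fin (n + 1), s (h, i) = d h

/-- The linear form `b_0 X_{h,0} + ⋯ + b_n X_{h,n}` in the `h`-th block of variables. -/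
noncomputable def linForm {F : Type*} [CommSemiring F] {m n : ℕ} (b : Fin (n + 1) → F)
    (h : Fin m) : MvPolynomial (Fin m × Fin (n + 1)) F :=
  ∑ i : Fin (n + 1), C (b i) * X (h, i)

/-- The ideal generated by the products `M_1(X_1)^{j_1} ⋯ M_m(X_m)^{j_m}` with
`j_1 / d_1 + ⋯ + j_m / d_m ≥ t`, where `M h` is the coefficient vector of the `h`-th form. -/
noncomputable def indexIdeal {F : Type*} [CommSemiring F] {m n : ℕ} (t : ℝ) (d : Fin m → ℕ)
    (M : Fin m → Fin (n + 1) → F) : Ideal (MvPolynomial (Fin m × Fin (n + 1)) F) :=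
  Ideal.span {f | ∃ J : Fin m → ℕ, t ≤ ∑ h : Fin m, (J h : ℝ) / (d h : ℝ) ∧
    f = ∏ h : Fin m, linForm (M h) h ^ J h}

/-- The index `sup {t ≥ 0 | P ∈ indexIdeal t d M}`, as an extended real number. -/
noncomputable def index {F : Type*} [CommSemiring F] {m n : ℕ} (d : Fin m → ℕ)
    (M : Fin m → Fin (n + 1) → F) (P : MvPolynomial (Fin m × Fin (n + 1)) F) : EReal :=
  sSup {y : EReal | ∃ t : ℝ, 0 ≤ t ∧ P ∈ indexIdeal t d M ∧ y = (t : EReal)}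

end GenRoth

/-! The assertion is reduced to the classical Roth lemma at a point `ξ`, and that lemma is proved by
induction on the number of variables with generalized Wronskians.

Reduction. In each form choose coordinates `i₀`, `i₁` such that `ξ_h = -M_h(i₁)/M_h(i₀)` has height
at least `h(M_h)/n` (`exists_ratio_height`). Put `X_{h,i₁} = 1` and solve for `X_{h,i₀}` so that
`M_h` becomes a constant times a new variable `Y_h`. In the image of `P`, take the coefficient at a
minimal exponent of the remaining variables. It is `f(Y + ξ)` for a nonzero `f` whose coefficients
are coefficients of `P` (`coeff_aeval_substVar`, `coeff_slice`). Hence `h(f) ≤ h(P)`, and membership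
of `P` in the index ideal for `t` makes `f` vanish at `ξ` to weighted order at least `t`.

Roth's lemma. Write `P = ∑ f_i g_i` with `n` terms, where the `g_i` involve only the last variable
and both families are linearly independent. Each family has a nonzero generalized Wronskian, say `U`
and `V`, and `U * V` is a determinant of derivatives of `P` (`exists_wronskian`). Its height is at
most about `n` times that of `P`. Its order at `ξ` is at least `n (min(t, t²)/2 - σ)`: derivatives
in the earlier variables are cheap because the degrees decrease fast. The order of `U` is bounded by
induction and that of `V` by the one-variable case, where a zero of large height cannot have large
multiplicity (`order_mul_height_le`). The quadratic lower bound costs a square root at every step,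
whence the exponent `1/2^(m-1)`. -/

namespace GenRoth

open MvPolynomial

/-! ### Partial degrees -/

section Degree

variable {ι R : Type*} [CommRing R]

/-- Every exponent occurring in `f` is bounded by `D`. -/
def DegLE (D : ι → ℕ) (f : MvPolynomial ι R) : Prop :=
  ∀ s, coeff s f ≠ 0 → ∀ i, s i ≤ D i

theorem DegLE.mono {D E : ι → ℕ} {f : MvPolynomial ι R} (hf : DegLE D f) (h : ∀ i, D i ≤ E i) :
    DegLE E f := fun s hs i => (hf s hs i).trans (h i)

theorem degLE_zero (D : ι → ℕ) : DegLE D (0 : MvPolynomial ι R) := by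
  intro s hs; simp at hs

theorem degLE_monomial {D : ι → ℕ} {s : ι →₀ ℕ} (h : ∀ i, s i ≤ D i) (a : R) :
    DegLE D (monomial s a) := by
  classical
  intro r hr
  rw [coeff_monomial] at hr
  split_ifs at hr with hsr
  · exact hsr ▸ h
  · exact absurd rfl hr

theorem degLE_one : DegLE 0 (1 : MvPolynomial ι R) :=
  degLE_monomial (s := 0) (fun _ => le_rfl) 1

theorem DegLE.add {D : ι → ℕ} {f g : MvPolynomial ι R} (hf : DegLE D f) (hg : DegLE D g) :
    DegLE D (f + g) := by
  intro s hs
  by_cases h : coeff s f = 0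
  · refine hg s fun h' => hs ?_
    rw [coeff_add, h, h', add_zero]
  · exact hf s h

theorem DegLE.sum {κ : Type*} {D : ι → ℕ} {f : κ → MvPolynomial ι R} (t : Finset κ)
    (hf : ∀ k ∈ t, DegLE D (f k)) : DegLE D (∑ k ∈ t, f k) := by
  classical
  induction t using Finset.induction_on with
  | empty => exact degLE_zero D
  | insert a t ha ih =>
    rw [Finset.sum_insert ha]
    exact (hf a (by simp)).add (ih fun k hk => hf k (by simp [hk]))

theorem DegLE.mul {D E : ι → ℕ} {f g : MvPolynomial ι R} (hf : DegLE D f) (hg : DegLE E g) :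
    DegLE (D + E) (f * g) := by
  classical
  intro s hs i
  rw [coeff_mul] at hs
  obtain ⟨p, hp, hne⟩ := Finset.exists_ne_zero_of_sum_ne_zero hs
  rw [Finset.HasAntidiagonal.mem_antidiagonal] at hp
  rw [← hp]
  exact add_le_add (hf _ (left_ne_zero_of_mul hne) i) (hg _ (right_ne_zero_of_mul hne) i)

theorem DegLE.prod {κ : Type*} {D : κ → ι → ℕ} {f : κ → MvPolynomial ι R} (t : Finset κ)
    (hf : ∀ k ∈ t, DegLE (D k) (f k)) : DegLE (∑ k ∈ t, D k) (∏ k ∈ t, f k) := by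
  classical
  induction t using Finset.induction_on with
  | empty => exact degLE_one
  | insert a t ha ih =>
    rw [Finset.sum_insert ha, Finset.prod_insert ha]
    exact (hf a (by simp)).mul (ih fun k hk => hf k (by simp [hk]))

theorem DegLE.pow {D : ι → ℕ} {f : MvPolynomial ι R} (hf : DegLE D f) (n : ℕ) :
    DegLE (n • D) (f ^ n) := by
  simpa using DegLE.prod (Finset.range n) (fun _ _ => hf)

theorem DegLE.smul {D : ι → ℕ} {f : MvPolynomial ι R} (hf : DegLE D f) (a : R) :
    DegLE D (a • f) := by
  intro s hs
  refine hf s fun h => hs ?_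
  rw [coeff_smul, h, smul_zero]

theorem DegLE.zsmul_unit {D : ι → ℕ} {f : MvPolynomial ι R} (hf : DegLE D f) (a : ℤˣ) :
    DegLE D (a • f) := by
  rcases Int.units_eq_one_or a with rfl | rfl
  · simpa using hf
  · intro s hs
    exact hf s fun h => hs (by simp [h])

theorem DegLE.pderiv {D : ι → ℕ} {f : MvPolynomial ι R} (hf : DegLE D f) (i : ι) :
    DegLE D (pderiv i f) := by
  classical
  intro s hs j
  rw [coeff_pderiv] at hs
  exact (Nat.le_add_right _ _).trans (hf _ (left_ne_zero_of_mul hs) j)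

theorem DegLE.det {n : ℕ} {D : ι → ℕ} {A : Matrix (Fin n) (Fin n) (MvPolynomial ι R)}
    (hA : ∀ i j, DegLE D (A i j)) : DegLE (n • D) A.det := by
  rw [Matrix.det_apply]
  refine DegLE.sum _ fun τ _ => DegLE.zsmul_unit ?_ _
  simpa using DegLE.prod Finset.univ (fun i _ => hA (τ i) i)

/-- In a product of polynomials in disjoint sets of variables, the coefficients multiply. -/
theorem coeff_add_mul_of_disjoint {D E : ι → ℕ} {f g : MvPolynomial ι R} (hf : DegLE D f)
    (hg : DegLE E g) (hDE : ∀ i, D i = 0 ∨ E i = 0) {s r : ι →₀ ℕ}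
    (hs : ∀ i, s i ≤ D i) (hr : ∀ i, r i ≤ E i) :
    coeff (s + r) (f * g) = coeff s f * coeff r g := by
  classical
  rw [coeff_mul, Finset.sum_eq_single (s, r)]
  · rintro ⟨a, b⟩ hab hne
    rw [Finset.HasAntidiagonal.mem_antidiagonal] at hab
    by_contra hcon
    refine hne ?_
    have ha := hf a (left_ne_zero_of_mul hcon)
    have hb := hg b (right_ne_zero_of_mul hcon)
    have key : ∀ i, a i = s i ∧ b i = r i := by
      intro i
      have h1 : a i + b i = s i + r i := DFunLike.congr_fun hab i
      have := ha i; have := hb i; have := hs i; have := hr i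
      rcases hDE i with h | h <;> omega
    exact Prod.ext (Finsupp.ext fun i => (key i).1) (Finsupp.ext fun i => (key i).2)
  · intro h
    exact absurd (by simp) h

end Degree

/-! ### Weighted order of vanishing at the origin -/

section Order

variable {ι R : Type*} [Fintype ι] [CommRing R]

/-- The weighted degree `∑ s_i / d_i` of an exponent. -/
noncomputable def weight (d : ι → ℕ) (s : ι →₀ ℕ) : ℝ := ∑ i, (s i : ℝ) / (d i : ℝ)

theorem weight_nonneg (d : ι → ℕ) (s : ι →₀ ℕ) : 0 ≤ weight d s :=
  Finset.sum_nonneg fun i _ => by positivity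

theorem weight_add (d : ι → ℕ) (s r : ι →₀ ℕ) : weight d (s + r) = weight d s + weight d r := by
  simp [weight, add_div, Finset.sum_add_distrib]

theorem weight_single [DecidableEq ι] (d : ι → ℕ) (i : ι) (k : ℕ) :
    weight d (Finsupp.single i k) = (k : ℝ) / d i := by
  rw [weight, Finset.sum_eq_single i]
  · simp
  · intro j _ hj
    simp [Finsupp.single_eq_of_ne hj]
  · simp

/-- The polynomials whose weighted order of vanishing at the origin is at least `t`. -/
noncomputable def orderIdeal (d : ι → ℕ) (t : ℝ) : Ideal (MvPolynomial ι R) where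
  carrier := {f | ∀ s, coeff s f ≠ 0 → t ≤ weight d s}
  zero_mem' := fun s hs => absurd (coeff_zero s) hs
  add_mem' := by
    intro f g hf hg s hs
    by_cases h : coeff s f = 0
    · refine hg s fun h' => hs ?_
      rw [coeff_add, h, h', add_zero]
    · exact hf s h
  smul_mem' := by
    classical
    intro f g hg s hs
    rw [smul_eq_mul, coeff_mul] at hs
    obtain ⟨p, hp, hne⟩ := Finset.exists_ne_zero_of_sum_ne_zero hs
    rw [Finset.HasAntidiagonal.mem_antidiagonal] at hp
    rw [← hp, weight_add]
    have := hg _ (right_ne_zero_of_mul hne)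
    have := weight_nonneg d p.1
    linarith

theorem orderIdeal_anti (d : ι → ℕ) {t u : ℝ} (h : t ≤ u) :
    (orderIdeal d u : Ideal (MvPolynomial ι R)) ≤ orderIdeal d t :=
  fun _ hf s hs => h.trans (hf s hs)

theorem mem_orderIdeal_of_nonpos (d : ι → ℕ) {t : ℝ} (h : t ≤ 0) (f : MvPolynomial ι R) :
    f ∈ orderIdeal d t := fun s _ => h.trans (weight_nonneg d s)

theorem mul_mem_orderIdeal {d : ι → ℕ} {t u : ℝ} {f g : MvPolynomial ι R}
    (hf : f ∈ orderIdeal d t) (hg : g ∈ orderIdeal d u) : f * g ∈ orderIdeal d (t + u) := by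
  classical
  intro s hs
  rw [coeff_mul] at hs
  obtain ⟨p, hp, hne⟩ := Finset.exists_ne_zero_of_sum_ne_zero hs
  rw [Finset.HasAntidiagonal.mem_antidiagonal] at hp
  rw [← hp, weight_add]
  exact add_le_add (hf _ (left_ne_zero_of_mul hne)) (hg _ (right_ne_zero_of_mul hne))

theorem prod_mem_orderIdeal {κ : Type*} {d : ι → ℕ} {t : κ → ℝ} {f : κ → MvPolynomial ι R}
    (S : Finset κ) (hf : ∀ k ∈ S, f k ∈ orderIdeal d (t k)) :
    ∏ k ∈ S, f k ∈ orderIdeal d (∑ k ∈ S, t k) := by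
  classical
  induction S using Finset.induction_on with
  | empty => exact mem_orderIdeal_of_nonpos d (by simp) _
  | insert a S ha ih =>
    rw [Finset.sum_insert ha, Finset.prod_insert ha]
    exact mul_mem_orderIdeal (hf a (by simp)) (ih fun k hk => hf k (by simp [hk]))

theorem det_mem_orderIdeal {n : ℕ} {d : ι → ℕ} {t : Fin n → ℝ}
    {A : Matrix (Fin n) (Fin n) (MvPolynomial ι R)}
    (hA : ∀ i j, A i j ∈ orderIdeal d (t j)) : A.det ∈ orderIdeal d (∑ j, t j) := by
  rw [Matrix.det_apply]
  refine Ideal.sum_mem _ fun τ _ => ?_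
  have := prod_mem_orderIdeal Finset.univ (fun i _ => hA (τ i) i)
  rcases Int.units_eq_one_or (Equiv.Perm.sign τ) with h | h
  · simpa [h] using this
  · simpa [h] using this

theorem pderiv_mem_orderIdeal {d : ι → ℕ} {t : ℝ} {f : MvPolynomial ι R}
    (hf : f ∈ orderIdeal d t) (i : ι) : pderiv i f ∈ orderIdeal d (t - 1 / d i) := by
  classical
  intro s hs
  rw [coeff_pderiv] at hs
  have := hf _ (left_ne_zero_of_mul hs)
  rw [weight_add, weight_single] at this
  push_cast at this
  linarith

/-- The weighted order of a product in disjoint sets of variables is at most the sum of the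
weighted orders. -/
theorem exists_orderIdeal_of_mul_mem [IsDomain R] {d D E : ι → ℕ} {T : ℝ}
    {f g : MvPolynomial ι R} (hf : DegLE D f)
    (hg : DegLE E g) (hDE : ∀ i, D i = 0 ∨ E i = 0) (hf0 : f ≠ 0) (hg0 : g ≠ 0)
    (h : f * g ∈ orderIdeal d T) :
    ∃ t u : ℝ, T ≤ t + u ∧ f ∈ orderIdeal d t ∧ g ∈ orderIdeal d u := by
  obtain ⟨s, hs, hsmin⟩ := f.support.exists_min_image (weight d) (support_nonempty.2 hf0)
  obtain ⟨r, hr, hrmin⟩ := g.support.exists_min_image (weight d) (support_nonempty.2 hg0)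
  rw [mem_support_iff] at hs hr
  refine ⟨weight d s, weight d r, ?_, fun a ha => hsmin a (mem_support_iff.2 ha),
    fun a ha => hrmin a (mem_support_iff.2 ha)⟩
  rw [← weight_add]
  apply h
  rw [coeff_add_mul_of_disjoint hf hg hDE (hf s hs) (hr := hg r hr)]
  exact mul_ne_zero hs hr

end Order

/-! ### Translation to a point -/

section Translate

variable {ι R : Type*} [CommRing R]

/-- The substitution `X_i ↦ X_i + ξ_i`. -/
noncomputable def translate (ξ : ι → R) : MvPolynomial ι R →ₐ[R] MvPolynomial ι R :=
  aeval fun i => X i + C (ξ i)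

@[simp]
theorem translate_X (ξ : ι → R) (i : ι) : translate ξ (X i) = X i + C (ξ i) := by
  simp [translate]

theorem translate_monomial (ξ : ι → R) (s : ι →₀ ℕ) (a : R) :
    translate ξ (monomial s a) = a • s.prod fun i k => (X i + C (ξ i)) ^ k := by
  rw [translate, aeval_monomial, Algebra.smul_def]

theorem translate_ne_zero (ξ : ι → R) {f : MvPolynomial ι R} (hf : f ≠ 0) :
    translate ξ f ≠ 0 := by
  have h : (translate (-ξ)).comp (translate ξ) = AlgHom.id R _ := by
    ext i : 1
    simp [translate]
  intro h0
  apply hf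
  have := DFunLike.congr_fun h f
  simpa [h0] using this.symm

theorem pderiv_translate (ξ : ι → R) (i : ι) (f : MvPolynomial ι R) :
    pderiv i (translate ξ f) = translate ξ (pderiv i f) := by
  classical
  induction f using MvPolynomial.induction_on with
  | C a => simp [translate]
  | add p q hp hq => simp [hp, hq]
  | mul_X p j hp =>
    rw [map_mul, pderiv_mul, hp, pderiv_mul, map_add, map_mul, map_mul]
    congr 2
    by_cases h : j = i
    · subst h; simp
    · simp [pderiv_X_of_ne h]

theorem DegLE.translate {D : ι → ℕ} {f : MvPolynomial ι R} (hf : DegLE D f) (ξ : ι → R) :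
    DegLE D (translate ξ f) := by
  classical
  rw [f.as_sum, map_sum]
  refine DegLE.sum _ fun s hs => ?_
  rw [translate_monomial]
  refine DegLE.smul ?_ _
  have h1 : ∀ i ∈ s.support, DegLE (s i • Pi.single i 1) ((X i + C (ξ i)) ^ s i) := by
    intro i _
    refine DegLE.pow (DegLE.add ?_ ?_) _
    · refine degLE_monomial (fun j => ?_) 1
      by_cases h : j = i
      · subst h; simp
      · simp [Finsupp.single_eq_of_ne h]
    · exact degLE_monomial (s := 0) (fun j => by simp) _
  refine (DegLE.prod s.support h1).mono fun i => ?_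
  rw [Finset.sum_apply]
  refine le_trans ?_ (hf s (mem_support_iff.1 hs) i)
  simp only [Pi.smul_apply, smul_eq_mul, Pi.single_apply, mul_ite, mul_one, mul_zero]
  rw [Finset.sum_ite_eq]
  split_ifs <;> simp

theorem map_translate {S : Type*} [CommRing S] (φ : R →+* S) (ξ : ι → R) (f : MvPolynomial ι R) :
    map φ (translate ξ f) = translate (fun i => φ (ξ i)) (map φ f) := by
  induction f using MvPolynomial.induction_on with
  | C a => simp [translate]
  | add p q hp hq => simp [hp, hq]
  | mul_X p j hp => simp [hp]

end Translate

/-! ### Generalized Wronskians -/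

section Wronskian

variable {ι K : Type*} [Field K]

/-- The iterated partial derivative with respect to the variables in a list. -/
noncomputable def derivs (l : List ι) (f : MvPolynomial ι K) : MvPolynomial ι K :=
  l.foldr (fun i g => pderiv i g) f

@[simp]
theorem derivs_nil (f : MvPolynomial ι K) : derivs [] f = f := rfl

@[simp]
theorem derivs_cons (i : ι) (l : List ι) (f : MvPolynomial ι K) :
    derivs (i :: l) f = pderiv i (derivs l f) := rfl

/-- Over a field of characteristic zero, polynomials with vanishing Wronskians with respect to
all variables are proportional. -/
theorem exists_eq_C_mul_of_pderiv [Finite ι] [LinearOrder ι] [CharZero K] {a b : MvPolynomial ι K}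
    (hb : b ≠ 0) (h : ∀ i, b * pderiv i a = a * pderiv i b) : ∃ c : K, a = C c * b := by
  classical
  let o : MonomialOrder ι := MonomialOrder.lex
  have hlb : coeff (o.degree b) b ≠ 0 := o.leadingCoeff_ne_zero_iff.2 hb
  refine ⟨coeff (o.degree b) a / coeff (o.degree b) b, ?_⟩
  set c := coeff (o.degree b) a / coeff (o.degree b) b with hc
  by_contra hne
  -- With this `c` the difference `g` has no term at the leading exponent of `b`. The operators `X_i
  -- ∂_i` multiply each coefficient by its `i`-th exponent, so comparing top coefficients in `b *
  -- X_i ∂_i g = g * X_i ∂_i b` shows that `g` has the same leading exponent as `b`, a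
  -- contradiction.
  set g := a - C c * b with hg
  have hg0 : g ≠ 0 := sub_ne_zero.2 hne
  have hlg : coeff (o.degree g) g ≠ 0 := o.leadingCoeff_ne_zero_iff.2 hg0
  have hgb : coeff (o.degree b) g = 0 := by
    rw [hg, coeff_sub, coeff_C_mul, hc, div_mul_cancel₀ _ hlb, sub_self]
  have hW : ∀ i, b * (X i * pderiv i g) = g * (X i * pderiv i b) := by
    intro i
    have := h i
    simp only [hg, map_sub, pderiv_C_mul]
    linear_combination X i * this
  have heuler : ∀ (i : ι) (p : MvPolynomial ι K) (s : ι →₀ ℕ),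
      coeff s (X i * pderiv i p) = (s i : K) * coeff s p := by
    intro i p s
    induction p using MvPolynomial.induction_on' with
    | monomial r a =>
      rw [X_mul_pderiv_monomial, coeff_smul, coeff_monomial, nsmul_eq_mul]
      split_ifs with hrs
      · rw [hrs]
      · simp
    | add p q hp hq => rw [map_add, mul_add, coeff_add, hp, hq, coeff_add, mul_add]
  have hdeg : ∀ (i : ι) (p : MvPolynomial ι K),
      o.toSyn (o.degree (X i * pderiv i p)) ≤ o.toSyn (o.degree p) := by
    intro i p
    rw [MonomialOrder.degree_le_iff]
    intro s hs
    rw [mem_support_iff, heuler] at hs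
    exact o.le_degree (mem_support_iff.2 (right_ne_zero_of_mul hs))
  have heq : ∀ i, o.degree g i = o.degree b i := by
    intro i
    have h1 := o.coeff_mul_of_add_of_degree_le (f := b) (g := X i * pderiv i g) le_rfl (hdeg i g)
    have h2 := o.coeff_mul_of_add_of_degree_le (f := g) (g := X i * pderiv i b) le_rfl (hdeg i b)
    rw [hW, add_comm, h2, heuler, heuler] at h1
    have h3 : coeff (o.degree g) g * coeff (o.degree b) b *
        ((o.degree b i : K) - (o.degree g i : K)) = 0 := by linear_combination h1
    have h4 := (mul_eq_zero.1 h3).resolve_left (mul_ne_zero hlg hlb)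
    exact_mod_cast (sub_eq_zero.1 h4).symm
  rw [Finsupp.ext heq] at hlg
  exact hlg hgb

/-- Generalized Wronskians: linearly independent polynomials have a nonvanishing determinant
of iterated partial derivatives, the `i`-th row having order at most `i`. -/
theorem exists_derivs_det_ne_zero [Finite ι] [LinearOrder ι] [CharZero K] (n : ℕ)
    (f : Fin n → MvPolynomial ι K) (hf : LinearIndependent K f) :
    ∃ l : Fin n → List ι, (∀ i, (l i).length ≤ i) ∧
      (Matrix.of fun i j => derivs (l i) (f j)).det ≠ 0 := by
  induction n with
  | zero => exact ⟨fun i => i.elim0, fun i => i.elim0, by simp⟩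
  | succ n ih =>
    obtain ⟨l, hl, hdet⟩ := ih (fun j => f j.castSucc)
      (hf.comp _ (Fin.castSucc_injective n))
    set A := Matrix.of fun i j : Fin n => derivs (l i) (f j.castSucc) with hA
    -- The cofactors along a new last row. They do not depend on the differential operator `L`
    -- chosen for that row.
    let a : Fin (n + 1) → MvPolynomial ι K := fun j => (-1) ^ (n + (j : ℕ)) *
      (Matrix.of fun i k : Fin n => derivs (l i) (f (j.succAbove k))).det
    have hexp : ∀ L : List ι, (Matrix.of fun i j : Fin (n + 1) =>
        derivs (Fin.snoc (α := fun _ => List ι) l L i) (f j)).det =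
          ∑ j, derivs L (f j) * a j := by
      intro L
      rw [Matrix.det_succ_row _ (Fin.last n)]
      refine Finset.sum_congr rfl fun j _ => ?_
      have : ((Matrix.of fun i j : Fin (n + 1) =>
          derivs (Fin.snoc (α := fun _ => List ι) l L i) (f j)).submatrix
          (Fin.last n).succAbove j.succAbove) =
          Matrix.of fun i k : Fin n => derivs (l i) (f (j.succAbove k)) := by
        ext i k : 2
        simp
      rw [this]
      simp only [Matrix.of_apply, Fin.snoc_last, Fin.val_last, a]
      ring
    have halast : a (Fin.last n) ≠ 0 := by
      have : a (Fin.last n) = A.det := by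
        simp only [a, Fin.val_last, Fin.succAbove_last, hA]
        rw [← two_mul, pow_mul]
        simp
      rw [this]
      exact hdet
    by_contra hcon
    push Not at hcon
    have hrel : ∀ L : List ι, L.length ≤ n → ∑ j, derivs L (f j) * a j = 0 := by
      intro L hL
      rw [← hexp]
      refine hcon (Fin.snoc (α := fun _ => List ι) l L) fun i => ?_
      refine Fin.lastCases ?_ (fun i => ?_) i
      · simpa using hL
      · simpa using hl i
    -- If every choice of last row gives zero, differentiate the relation for `l k` and subtract the
    -- one for `i :: l k`, whose order is still at most `n`. The result is `∑ ∂^(l k) f_j * ∂_i a_j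
    -- = 0`. Eliminating the last column leaves a vector killed by the nonsingular `A`, so the
    -- cofactors are proportional; the relation for `L = []` then contradicts independence.
    have hconst : ∀ j, ∃ c : K, a j = C c * a (Fin.last n) := by
      have hz : ∀ (i : ι) (j : Fin n), a (Fin.last n) * pderiv i (a j.castSucc) -
          a j.castSucc * pderiv i (a (Fin.last n)) = 0 := by
        intro i
        have hmv : A.mulVec (fun j : Fin n => a (Fin.last n) * pderiv i (a j.castSucc) -
          a j.castSucc * pderiv i (a (Fin.last n))) = 0 := by
          funext k
          have h1 := hrel (l k) ((hl k).trans k.2.le)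
          have h2 : ∑ j, derivs (l k) (f j) * pderiv i (a j) = 0 := by
            have h3 := hrel (i :: l k) (by simpa using lt_of_le_of_lt (hl k) k.2)
            have h4 := congrArg (pderiv i) h1
            rw [map_zero, map_sum] at h4
            simp only [pderiv_mul, Finset.sum_add_distrib] at h4
            simp only [derivs_cons] at h3
            rwa [h3, zero_add] at h4
          rw [Fin.sum_univ_castSucc] at h1 h2
          simp only [Matrix.mulVec, dotProduct, hA, Matrix.of_apply, Pi.zero_apply]
          have h5 : ∀ j : Fin n, derivs (l k) (f j.castSucc) *
              (a (Fin.last n) * pderiv i (a j.castSucc) -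
              a j.castSucc * pderiv i (a (Fin.last n))) =
              a (Fin.last n) * (derivs (l k) (f j.castSucc) * pderiv i (a j.castSucc)) -
              pderiv i (a (Fin.last n)) * (derivs (l k) (f j.castSucc) * a j.castSucc) := by
            intro j; ring
          rw [Finset.sum_congr rfl fun j _ => h5 j, Finset.sum_sub_distrib, ← Finset.mul_sum,
            ← Finset.mul_sum]
          linear_combination a (Fin.last n) * h2 - pderiv i (a (Fin.last n)) * h1
        exact congrFun (Matrix.eq_zero_of_mulVec_eq_zero hdet hmv)
      intro j
      refine Fin.lastCases ⟨1, by simp⟩ (fun j => ?_) j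
      exact exists_eq_C_mul_of_pderiv halast fun i => sub_eq_zero.1 (hz i j)
    choose c hc using hconst
    have h0 := hrel [] (Nat.zero_le n)
    have h1 : a (Fin.last n) * ∑ j, c j • f j = 0 := by
      rw [← h0, Finset.mul_sum]
      refine Finset.sum_congr rfl fun j _ => ?_
      rw [derivs_nil, hc j, smul_eq_C_mul]
      ring
    have h2 := Fintype.linearIndependent_iff.1 hf c ((mul_eq_zero.1 h1).resolve_left halast)
    exact halast (by rw [hc, h2, map_zero, zero_mul])

end Wronskian

/-! ### Heights of vectors and polynomials -/

section Height

open Height AdmissibleAbsValues Function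

/-- Zero coordinates do not affect the supremum, and each nonzero coordinate has absolute value one
at almost all places. -/
theorem hasFiniteMulSupport_iSup {K ι : Type*} [Field K] [AdmissibleAbsValues K] [Finite ι]
    {x : ι → K} (hx : x ≠ 0) :
    (fun v : nonarchAbsVal (K := K) ↦ ⨆ i, v.val (x i)).HasFiniteMulSupport := by
  have : Nonempty {j // x j ≠ 0} := nonempty_subtype.mpr <| ne_iff.mp hx
  suffices (fun v : nonarchAbsVal (K := K) ↦
      ⨆ i : {j // x j ≠ 0}, v.val (x i)).HasFiniteMulSupport by
    convert! this with v
    obtain ⟨i, hi⟩ : ∃ j, x j ≠ 0 := Function.ne_iff.mp hx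
    have : Nonempty ι := .intro i
    refine le_antisymm (ciSup_le fun j ↦ ?_) (ciSup_le fun ⟨j, hj⟩ ↦ Finite.le_ciSup_of_le j le_rfl)
    rcases eq_or_ne (x j) 0 with h | h
    · rw [h, v.val.map_zero]
      exact Real.iSup_nonneg' ⟨⟨i, hi⟩, v.val.nonneg ..⟩
    · exact Finite.le_ciSup_of_le ⟨j, h⟩ le_rfl
  fun_prop (disch := grind)

/-- Comparison of heights from comparisons at all places. -/
theorem logHeight_le_of_local {K ι ι' : Type*} [Field K] [AdmissibleAbsValues K] [Finite ι]
    [Finite ι'] {x : ι → K} {y : ι' → K} (hx : x ≠ 0) (hy : y ≠ 0) (N : ℕ) {A : ℝ} (hA : 0 < A)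
    (harch : ∀ v ∈ archAbsVal (K := K), ∀ i, v (x i) ≤ A * (⨆ j, v (y j)) ^ N)
    (hnon : ∀ v ∈ nonarchAbsVal (K := K), ∀ i, v (x i) ≤ (⨆ j, v (y j)) ^ N) :
    logHeight x ≤ totalWeight K * Real.log A + N * logHeight y := by
  have : Nonempty ι := .intro (ne_iff.mp hx).choose
  have hS : ∀ v : AbsoluteValue K ℝ, 0 ≤ ⨆ j, v (y j) := fun v =>
    Real.iSup_nonneg_of_nonnegHomClass v _
  have key : mulHeight x ≤ A ^ totalWeight K * mulHeight y ^ N := by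
    rw [mulHeight_eq hx, mulHeight_eq hy, mul_pow, ← mul_assoc, ← Multiset.prod_map_pow,
      totalWeight, ← Multiset.prod_replicate, ← Multiset.map_const', ← Multiset.prod_map_mul,
      finprod_pow (hasFiniteMulSupport_iSup hy)]
    gcongr
    · exact finprod_nonneg fun v ↦ Real.iSup_nonneg_of_nonnegHomClass v.val _
    · refine Multiset.prod_map_nonneg fun v _ ↦ mul_nonneg hA.le (pow_nonneg (hS v) _)
    · exact Multiset.prod_map_le_prod_map₀ _ _
        (fun v _ ↦ Real.iSup_nonneg_of_nonnegHomClass v _) fun v hv ↦ ciSup_le (harch v hv)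
    · refine finprod_le_finprod (hasFiniteMulSupport_iSup hx)
        (fun v ↦ Real.iSup_nonneg_of_nonnegHomClass v.val _) ?_
        fun v ↦ ciSup_le (hnon v.1 v.2)
      exact (hasFiniteMulSupport_iSup hy).pow N
  have h2 := Real.log_le_log (mulHeight_pos x) key
  rwa [Real.log_mul (pow_pos hA _).ne' (pow_pos (mulHeight_pos y) _).ne', Real.log_pow,
    Real.log_pow, ← logHeight_eq_log_mulHeight, ← logHeight_eq_log_mulHeight] at h2

variable {K : Type*} [Field K] [NumberField K]

theorem finrank_pos' : (0 : ℝ) < Module.finrank ℚ K := by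
  exact_mod_cast Module.finrank_pos

theorem absHeight_le_of_local {ι ι' : Type*} [Finite ι]
    [Finite ι'] {x : ι → K} {y : ι' → K} (hx : x ≠ 0) (hy : y ≠ 0) (N : ℕ) {A : ℝ} (hA : 0 < A)
    (harch : ∀ v ∈ archAbsVal (K := K), ∀ i, v (x i) ≤ A * (⨆ j, v (y j)) ^ N)
    (hnon : ∀ v ∈ nonarchAbsVal (K := K), ∀ i, v (x i) ≤ (⨆ j, v (y j)) ^ N) :
    absHeight x ≤ Real.log A + N * absHeight y := by
  have h := logHeight_le_of_local hx hy N hA harch hnon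
  rw [NumberField.totalWeight_eq_finrank] at h
  have hp := finrank_pos' (K := K)
  rw [absHeight, absHeight, div_le_iff₀ hp]
  have : (Real.log A + N * (logHeight y / (Module.finrank ℚ K : ℝ))) * (Module.finrank ℚ K : ℝ) =
      Module.finrank ℚ K * Real.log A + N * logHeight y := by
    field_simp
  rw [this]
  exact h

theorem absHeight_nonneg {ι : Type*} [Finite ι] (x : ι → K) : 0 ≤ absHeight x :=
  div_nonneg (logHeight_nonneg x) (Nat.cast_nonneg _)

theorem absHeight_comp_le {ι ι' : Type*} [Finite ι] [Finite ι'] (f : ι → ι') (x : ι' → K) :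
    absHeight (x ∘ f) ≤ absHeight x :=
  div_le_div_of_nonneg_right (logHeight_comp_le f x) (Nat.cast_nonneg _)

theorem absHeight_smul {ι : Type*} [Finite ι] (x : ι → K) {c : K} (hc : c ≠ 0) :
    absHeight (c • x) = absHeight x := by
  rw [absHeight, absHeight, logHeight_smul_eq_logHeight x hc]

variable {ι : Type*}

theorem coeffs_ne_zero {K ι : Type*} [Field K] {P : MvPolynomial ι K} (hP : P ≠ 0) :
    (fun s : P.support => P.coeff s.1) ≠ 0 := by
  obtain ⟨s, hs⟩ := support_nonempty.2 hP
  exact ne_iff.2 ⟨⟨s, hs⟩, mem_support_iff.1 hs⟩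

theorem polyHeight_nonneg (P : MvPolynomial ι K) : 0 ≤ polyHeight P := absHeight_nonneg _

/-- If the coefficients of `Q` occur among those of `P`, then the height of `Q` is at most that
of `P`. -/
theorem polyHeight_le_of_coeff {κ : Type*} {P : MvPolynomial ι K} {Q : MvPolynomial κ K}
    (e : (κ →₀ ℕ) → ι →₀ ℕ)
    (h : ∀ s, coeff s Q ≠ 0 → coeff s Q = coeff (e s) P) : polyHeight Q ≤ polyHeight P := by
  have hmem : ∀ s : Q.support, e s.1 ∈ P.support := fun s => by
    have h1 := mem_support_iff.1 s.2
    rw [mem_support_iff, ← h s.1 h1]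
    exact h1
  have := absHeight_comp_le (fun s : Q.support => (⟨e s.1, hmem s⟩ : P.support))
    (fun s : P.support => P.coeff s.1)
  refine le_trans (le_of_eq ?_) this
  rw [polyHeight]
  congr 1
  funext s
  exact h s.1 (mem_support_iff.1 s.2)

theorem polyHeight_smul_le (P : MvPolynomial ι K) {c : K} (hc : c ≠ 0) :
    polyHeight P ≤ polyHeight (c • P) := by
  have hmem : ∀ s : P.support, s.1 ∈ (c • P).support := fun s => by
    rw [mem_support_iff, coeff_smul, smul_eq_mul]
    exact mul_ne_zero hc (mem_support_iff.1 s.2)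
  have := absHeight_comp_le (fun s : P.support => (⟨s.1, hmem s⟩ : (c • P).support))
    (fun s : (c • P).support => (c • P).coeff s.1)
  refine le_trans (le_of_eq ?_) this
  rw [polyHeight, ← absHeight_smul _ hc]
  rfl

/-- The height of a product in disjoint sets of variables is at least the sum of the heights. -/
theorem polyHeight_add_le_of_disjoint {D E : ι → ℕ} {f g : MvPolynomial ι K} (hf : DegLE D f)
    (hg : DegLE E g) (hDE : ∀ i, D i = 0 ∨ E i = 0) (hf0 : f ≠ 0) (hg0 : g ≠ 0) :
    polyHeight f + polyHeight g ≤ polyHeight (f * g) := by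
  have hco : ∀ a : f.support × g.support, coeff (a.1.1 + a.2.1) (f * g) =
      coeff a.1.1 f * coeff a.2.1 g := fun a =>
    coeff_add_mul_of_disjoint hf hg hDE (hf _ (mem_support_iff.1 a.1.2))
      (hg _ (mem_support_iff.1 a.2.2))
  have hmem : ∀ a : f.support × g.support, a.1.1 + a.2.1 ∈ (f * g).support := fun a => by
    rw [mem_support_iff, hco]
    exact mul_ne_zero (mem_support_iff.1 a.1.2) (mem_support_iff.1 a.2.2)
  -- The coefficients of `f * g` include all products of a coefficient of `f` with one of `g`, and
  -- the height of that tensor product is the sum of the heights.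
  have := absHeight_comp_le
    (fun a : f.support × g.support => (⟨a.1.1 + a.2.1, hmem a⟩ : (f * g).support))
    (fun s : (f * g).support => (f * g).coeff s.1)
  refine le_trans (le_of_eq ?_) this
  rw [polyHeight, polyHeight, absHeight, absHeight, ← add_div,
    ← logHeight_fun_mul_eq (coeffs_ne_zero hf0) (coeffs_ne_zero hg0), absHeight]
  congr 2
  funext a
  exact (hco a).symm

end Height

/-! ### Local bounds for coefficients of products and determinants -/

section LocalBounds

variable {ι K : Type*} [Field K]

/-- The sum of the absolute values of the coefficients. -/
noncomputable def length (v : AbsoluteValue K ℝ) (f : MvPolynomial ι K) : ℝ :=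
  ∑ s ∈ f.support, v (coeff s f)

theorem length_nonneg (v : AbsoluteValue K ℝ) (f : MvPolynomial ι K) : 0 ≤ length v f :=
  Finset.sum_nonneg fun _ _ => v.nonneg _

theorem length_eq_sum (v : AbsoluteValue K ℝ) (f : MvPolynomial ι K) {T : Finset (ι →₀ ℕ)}
    (hT : f.support ⊆ T) : length v f = ∑ s ∈ T, v (coeff s f) :=
  Finset.sum_subset hT fun s _ hs => by rw [notMem_support_iff.1 hs, map_zero]

theorem coeff_le_length (v : AbsoluteValue K ℝ) (f : MvPolynomial ι K) (s : ι →₀ ℕ) :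
    v (coeff s f) ≤ length v f := by
  by_cases hs : s ∈ f.support
  · exact Finset.single_le_sum (f := fun s => v (coeff s f)) (fun _ _ => v.nonneg _) hs
  · rw [notMem_support_iff.1 hs, map_zero]
    exact length_nonneg v f

theorem length_add_le (v : AbsoluteValue K ℝ) (f g : MvPolynomial ι K) :
    length v (f + g) ≤ length v f + length v g := by
  classical
  rw [length_eq_sum v (f + g) support_add, length_eq_sum v f Finset.subset_union_left,
    length_eq_sum v g Finset.subset_union_right, ← Finset.sum_add_distrib]
  exact Finset.sum_le_sum fun s _ => by rw [coeff_add]; exact v.add_le _ _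

theorem length_sum_le {κ : Type*} (v : AbsoluteValue K ℝ) (T : Finset κ)
    (f : κ → MvPolynomial ι K) : length v (∑ k ∈ T, f k) ≤ ∑ k ∈ T, length v (f k) := by
  classical
  induction T using Finset.induction_on with
  | empty => simp [length]
  | insert a T ha ih =>
    rw [Finset.sum_insert ha, Finset.sum_insert ha]
    exact (length_add_le v _ _).trans (by gcongr)

theorem length_monomial_le (v : AbsoluteValue K ℝ) (s : ι →₀ ℕ) (a : K) :
    length v (monomial s a) ≤ v a := by
  classical
  rw [length_eq_sum v _ support_monomial_subset]
  simp

theorem length_mul_le (v : AbsoluteValue K ℝ) (f g : MvPolynomial ι K) :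
    length v (f * g) ≤ length v f * length v g := by
  conv_lhs => rw [f.as_sum, g.as_sum, Finset.sum_mul_sum]
  refine (length_sum_le v _ _).trans ?_
  rw [length, length, Finset.sum_mul_sum]
  refine Finset.sum_le_sum fun s _ => (length_sum_le v _ _).trans ?_
  refine Finset.sum_le_sum fun r _ => ?_
  rw [monomial_mul, ← map_mul]
  exact length_monomial_le v _ _

theorem length_prod_le {κ : Type*} (v : AbsoluteValue K ℝ) (T : Finset κ)
    (f : κ → MvPolynomial ι K) : length v (∏ k ∈ T, f k) ≤ ∏ k ∈ T, length v (f k) := by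
  classical
  induction T using Finset.induction_on with
  | empty =>
    refine (length_monomial_le v 0 1).trans ?_
    simp
  | insert a T ha ih =>
    rw [Finset.prod_insert ha, Finset.prod_insert ha]
    refine (length_mul_le v _ _).trans ?_
    gcongr
    exact length_nonneg v _

theorem length_units_smul (v : AbsoluteValue K ℝ) (u : ℤˣ) (f : MvPolynomial ι K) :
    length v (u • f) = length v f := by
  rcases Int.units_eq_one_or u with rfl | rfl
  · simp
  · simp [length]

theorem length_det_le (v : AbsoluteValue K ℝ) {n : ℕ}
    (A : Matrix (Fin n) (Fin n) (MvPolynomial ι K)) {B : ℝ} (hA : ∀ i j, length v (A i j) ≤ B) :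
    length v A.det ≤ n.factorial * B ^ n := by
  rw [Matrix.det_apply]
  refine (length_sum_le v _ _).trans ?_
  have h : ∀ τ ∈ (Finset.univ : Finset (Equiv.Perm (Fin n))),
      length v (Equiv.Perm.sign τ • ∏ i, A (τ i) i) ≤ B ^ n := by
    intro τ _
    rw [length_units_smul]
    refine (length_prod_le v _ _).trans ?_
    refine (Finset.prod_le_prod (fun i _ => length_nonneg v _) fun i _ => hA (τ i) i).trans ?_
    simp
  refine (Finset.sum_le_sum h).trans ?_
  simp [Fintype.card_perm]

variable {v : AbsoluteValue K ℝ}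

theorem IsNonarchimedean.sum_le_of_le (hv : IsNonarchimedean v) {κ : Type*} (T : Finset κ)
    {f : κ → K} {B : ℝ} (hB : 0 ≤ B) (hf : ∀ k ∈ T, v (f k) ≤ B) : v (∑ k ∈ T, f k) ≤ B := by
  classical
  induction T using Finset.induction_on with
  | empty => simpa using hB
  | insert a T ha ih =>
    rw [Finset.sum_insert ha]
    exact (hv _ _).trans (max_le (hf a (by simp)) (ih fun k hk => hf k (by simp [hk])))

theorem IsNonarchimedean.natCast_le_one (hv : IsNonarchimedean v) (n : ℕ) : v (n : K) ≤ 1 := by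
  induction n with
  | zero => simp
  | succ n ih =>
    push_cast
    exact (hv _ _).trans (max_le ih (by simp))

theorem IsNonarchimedean.coeff_mul_le (hv : IsNonarchimedean v) {f g : MvPolynomial ι K}
    {A B : ℝ} (hA : 0 ≤ A) (hB : 0 ≤ B) (hf : ∀ s, v (coeff s f) ≤ A)
    (hg : ∀ s, v (coeff s g) ≤ B) (s : ι →₀ ℕ) : v (coeff s (f * g)) ≤ A * B := by
  classical
  rw [coeff_mul]
  refine IsNonarchimedean.sum_le_of_le hv _ (mul_nonneg hA hB) fun p _ => ?_
  rw [map_mul]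
  exact mul_le_mul (hf _) (hg _) (v.nonneg _) hA

theorem IsNonarchimedean.coeff_prod_le (hv : IsNonarchimedean v) {κ : Type*} (T : Finset κ)
    {f : κ → MvPolynomial ι K} {B : ℝ} (hB : 0 ≤ B) (hf : ∀ k ∈ T, ∀ s, v (coeff s (f k)) ≤ B)
    (s : ι →₀ ℕ) : v (coeff s (∏ k ∈ T, f k)) ≤ B ^ T.card := by
  classical
  induction T using Finset.induction_on generalizing s with
  | empty =>
    simp only [Finset.prod_empty, Finset.card_empty, pow_zero, coeff_one]
    split_ifs <;> simp
  | insert a T ha ih =>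
    rw [Finset.prod_insert ha, Finset.card_insert_of_notMem ha, pow_succ']
    exact IsNonarchimedean.coeff_mul_le hv hB (pow_nonneg hB _) (hf a (by simp))
      (fun s => ih (fun k hk => hf k (by simp [hk])) s) s

theorem IsNonarchimedean.coeff_det_le (hv : IsNonarchimedean v) {n : ℕ}
    (A : Matrix (Fin n) (Fin n) (MvPolynomial ι K)) {B : ℝ} (hB : 0 ≤ B)
    (hA : ∀ i j s, v (coeff s (A i j)) ≤ B) (s : ι →₀ ℕ) : v (coeff s A.det) ≤ B ^ n := by
  rw [Matrix.det_apply, coeff_sum]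
  refine IsNonarchimedean.sum_le_of_le hv _ (pow_nonneg hB _) fun τ _ => ?_
  have := IsNonarchimedean.coeff_prod_le hv Finset.univ hB (fun i _ => hA (τ i) i) s
  rw [Finset.card_univ, Fintype.card_fin] at this
  rcases Int.units_eq_one_or (Equiv.Perm.sign τ) with h | h
  · simpa [h] using this
  · simpa [h] using this

end LocalBounds

/-! ### Iterated partial derivatives -/

section Derivs

variable {ι K : Type*} [Field K]

/-- The exponent counting how often each variable occurs in a list. -/
noncomputable def expo (l : List ι) : ι →₀ ℕ := (l.map fun i => Finsupp.single i 1).sum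

@[simp]
theorem expo_nil : expo ([] : List ι) = 0 := rfl

theorem expo_cons (i : ι) (l : List ι) : expo (i :: l) = Finsupp.single i 1 + expo l := by
  simp [expo]

theorem expo_append (l l' : List ι) : expo (l ++ l') = expo l + expo l' := by
  simp [expo]

theorem expo_apply_eq_zero {l : List ι} {i : ι} (h : i ∉ l) : expo l i = 0 := by
  classical
  induction l with
  | nil => simp
  | cons j l ih =>
    rw [List.mem_cons, not_or] at h
    rw [expo_cons, Finsupp.add_apply, ih h.2, Finsupp.single_eq_of_ne h.1]

/-- The factorials do not depend on `s`, so they can be scaled out of a determinant. What remains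
are binomial coefficients, which are exponentially bounded in the degrees; this keeps the height
loss linear. -/
theorem coeff_derivs [Fintype ι] (l : List ι) (P : MvPolynomial ι K) (s : ι →₀ ℕ) :
    coeff s (derivs l P) = ((∏ i, (expo l i).factorial : ℕ) : K) *
      ((∏ i, (s i + expo l i).choose (expo l i) : ℕ) : K) * coeff (s + expo l) P := by
  classical
  induction l generalizing s with
  | nil => simp
  | cons j l ih =>
    rw [derivs_cons, coeff_pderiv, ih, expo_cons, ← add_assoc]
    have key : (∏ i, (expo l i).factorial) *
        (∏ i, ((s + Finsupp.single j 1 : ι →₀ ℕ) i + expo l i).choose (expo l i)) * (s j + 1) =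
        (∏ i, ((Finsupp.single j 1 + expo l : ι →₀ ℕ) i).factorial) *
        (∏ i, (s i + (Finsupp.single j 1 + expo l : ι →₀ ℕ) i).choose
          ((Finsupp.single j 1 + expo l : ι →₀ ℕ) i)) := by
      rw [← Finset.prod_mul_distrib, ← Finset.prod_mul_distrib,
        ← Finset.mul_prod_erase _ _ (Finset.mem_univ j),
        ← Finset.mul_prod_erase _ _ (Finset.mem_univ j), mul_right_comm]
      congr 1
      · simp only [Finsupp.add_apply, Finsupp.single_eq_same]
        set e := expo l j
        have h := Nat.choose_succ_right_eq (s j + 1 + e) e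
        rw [Nat.add_sub_cancel] at h
        rw [show s j + (1 + e) = s j + 1 + e by ring, show 1 + e = e + 1 by ring,
          Nat.factorial_succ]
        rw [mul_assoc, ← h]
        ring
      · refine Finset.prod_congr rfl fun i hi => ?_
        simp [Finsupp.single_eq_of_ne (Finset.ne_of_mem_erase hi)]
    rw [mul_right_comm]
    congr 1
    exact_mod_cast congrArg (Nat.cast : ℕ → K) key

theorem derivs_append (l l' : List ι) (f : MvPolynomial ι K) :
    derivs (l ++ l') f = derivs l (derivs l' f) := by
  simp [derivs, List.foldr_append]

theorem DegLE.derivs {D : ι → ℕ} {f : MvPolynomial ι K} (hf : DegLE D f) (l : List ι) :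
    DegLE D (derivs l f) := by
  induction l with
  | nil => exact hf
  | cons i l ih => exact ih.pderiv i

theorem derivs_eq_zero_of_mem {D : ι → ℕ} {f : MvPolynomial ι K} (hf : DegLE D f) {l : List ι}
    {i : ι} (hi : i ∈ l) (hD : D i = 0) : derivs l f = 0 := by
  classical
  induction l with
  | nil => simp at hi
  | cons j l ih =>
    rw [derivs_cons]
    rcases List.mem_cons.1 hi with rfl | h
    · ext s
      rw [coeff_pderiv, coeff_zero]
      by_contra hne
      have := hf.derivs l _ (left_ne_zero_of_mul hne) i
      simp [hD] at this
    · rw [ih h, map_zero]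

theorem derivs_translate (ξ : ι → K) (l : List ι) (f : MvPolynomial ι K) :
    derivs l (translate ξ f) = translate ξ (derivs l f) := by
  induction l with
  | nil => rfl
  | cons i l ih => rw [derivs_cons, ih, pderiv_translate, derivs_cons]

theorem derivs_mem_orderIdeal [Fintype ι] {d : ι → ℕ} {t : ℝ} {f : MvPolynomial ι K}
    (hf : f ∈ orderIdeal d t) (l : List ι) :
    derivs l f ∈ orderIdeal d (t - weight d (expo l)) := by
  classical
  induction l with
  | nil => simpa [weight] using hf
  | cons i l ih =>
    have := pderiv_mem_orderIdeal ih i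
    have he : t - weight d (expo (i :: l)) = t - weight d (expo l) - 1 / d i := by
      rw [expo_cons, weight_add, weight_single]
      push_cast
      ring
    rwa [he, derivs_cons]

theorem derivs_sum {κ : Type*} (l : List ι) (T : Finset κ) (f : κ → MvPolynomial ι K) :
    derivs l (∑ k ∈ T, f k) = ∑ k ∈ T, derivs l (f k) := by
  induction l with
  | nil => rfl
  | cons i l ih => rw [derivs_cons, ih, map_sum]; rfl

/-- Differentiation of a product with a factor that is constant in the variables of the list. -/
theorem derivs_mul_of_disjoint {D : ι → ℕ} {f g : MvPolynomial ι K} (hg : DegLE D g)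
    (l : List ι) (hl : ∀ i ∈ l, D i = 0) : derivs l (f * g) = derivs l f * g := by
  induction l with
  | nil => rfl
  | cons i l ih =>
    rw [derivs_cons, ih fun j hj => hl j (by simp [hj]), pderiv_mul, derivs_cons]
    have : pderiv i g = 0 := derivs_eq_zero_of_mem hg (List.mem_singleton_self i) (hl i (by simp))
    rw [this, mul_zero, add_zero]

end Derivs

/-! ### Height of a determinant of derivatives -/

section DetHeight

open Height AdmissibleAbsValues

variable {ι K : Type*} [Fintype ι] [Field K] [NumberField K]

theorem card_support_le {ι K : Type*} [Fintype ι] [Field K] {D : ι → ℕ} {P : MvPolynomial ι K} (hP : DegLE D P) :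
    P.support.card ≤ 2 ^ ∑ i, D i := by
  classical
  have h1 : P.support.card ≤ (Fintype.piFinset fun i => Finset.range (D i + 1)).card := by
    refine Finset.card_le_card_of_injOn (fun s => (s : ι → ℕ)) (fun s hs => ?_)
      (fun s _ r _ h => DFunLike.coe_injective h)
    simp only [Fintype.coe_piFinset, Finset.coe_range, Set.mem_pi, Set.mem_univ, Set.mem_Iio,
      forall_true_left]
    exact fun i => Nat.lt_succ_of_le (hP s (mem_support_iff.1 hs) i)
  refine h1.trans ?_
  rw [Fintype.card_piFinset, ← Finset.prod_pow_eq_pow_sum]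
  exact Finset.prod_le_prod' fun i _ => by rw [Finset.card_range]; exact Nat.lt_two_pow_self

/-- Height bound for determinants of polynomials whose coefficients are products of binomial
coefficients with coefficients of a fixed polynomial. -/
theorem polyHeight_det_le {n : ℕ} {A : Matrix (Fin n) (Fin n) (MvPolynomial ι K)}
    {P : MvPolynomial ι K} {D : ι → ℕ} (hP : DegLE D P) (hP0 : P ≠ 0) (hdet : A.det ≠ 0)
    (hA : ∀ i j, ∃ e : ι →₀ ℕ, ∀ s, coeff s (A i j) =
      ((∏ i, (s i + e i).choose (e i) : ℕ) : K) * coeff (s + e) P) :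
    polyHeight A.det ≤
      n * (polyHeight P + Real.log n + 2 * (∑ i, D i : ℕ) * Real.log 2) := by
  rcases Nat.eq_zero_or_pos n with rfl | hn
  · simp only [Matrix.det_fin_zero, Nat.cast_zero, zero_mul]
    have : polyHeight (1 : MvPolynomial ι K) ≤
        polyHeight (monomial (0 : ι →₀ ℕ) (1 : K)) := le_rfl
    refine this.trans (le_of_eq ?_)
    have hs : Subsingleton (monomial (0 : ι →₀ ℕ) (1 : K)).support :=
      ⟨fun a b => Subtype.ext (by
        have ha := support_monomial_subset a.2
        have hb := support_monomial_subset b.2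
        rw [Finset.mem_singleton] at ha hb
        rw [ha, hb])⟩
    rw [polyHeight, absHeight, logHeight_eq_zero_of_subsingleton, zero_div]
  set S := ∑ i, D i with hS
  have hsup : ∀ (v : AbsoluteValue K ℝ) (s : ι →₀ ℕ),
      v (coeff s P) ≤ ⨆ r : P.support, v (P.coeff r.1) := by
    intro v s
    by_cases hs : s ∈ P.support
    · exact Finite.le_ciSup_of_le (⟨s, hs⟩ : P.support) le_rfl
    · rw [notMem_support_iff.1 hs, map_zero]
      exact Real.iSup_nonneg_of_nonnegHomClass v _
  have harch : ∀ v : AbsoluteValue K ℝ, ∀ s : A.det.support, v (A.det.coeff s.1) ≤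
      ((n : ℝ) * (2 ^ (2 * S))) ^ n * (⨆ r : P.support, v (P.coeff r.1)) ^ n := by
    intro v s
    set B := ⨆ r : P.support, v (P.coeff r.1) with hB
    have hB0 : 0 ≤ B := Real.iSup_nonneg_of_nonnegHomClass v _
    -- One factor `2 ^ S` bounds the number of monomials, the other the product of binomial
    -- coefficients. The factor `n ^ n` of the final bound comes from `n!` in the determinant.
    have hent : ∀ i j, length v (A i j) ≤ 2 ^ (2 * S) * B := by
      intro i j
      obtain ⟨e, he⟩ := hA i j
      have hne : ∀ s ∈ (A i j).support, coeff (s + e) P ≠ 0 := fun s hs => by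
        rw [mem_support_iff, he] at hs
        exact right_ne_zero_of_mul hs
      have hterm : ∀ s ∈ (A i j).support, v (coeff s (A i j)) ≤ 2 ^ S * B := by
        intro s hs
        rw [he, map_mul]
        refine mul_le_mul ?_ (hsup v _) (v.nonneg _) (by positivity)
        have h1 : v ((∏ i, (s i + e i).choose (e i) : ℕ) : K) ≤
            ((∏ i, (s i + e i).choose (e i) : ℕ) : ℝ) := by
          generalize (∏ i, (s i + e i).choose (e i) : ℕ) = N
          induction N with
          | zero => simp
          | succ N ih =>
            push_cast
            exact (v.add_le _ _).trans (by rw [map_one]; gcongr)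
        refine h1.trans ?_
        have h2 : ∏ i, (s i + e i).choose (e i) ≤ 2 ^ S := by
          rw [hS, ← Finset.prod_pow_eq_pow_sum]
          refine Finset.prod_le_prod' fun i _ => (Nat.choose_le_two_pow _ _).trans ?_
          exact Nat.pow_le_pow_right (by norm_num) (hP _ (hne s hs) i)
        exact_mod_cast h2
      have hcard : (A i j).support.card ≤ 2 ^ S := by
        refine le_trans ?_ (card_support_le hP)
        refine Finset.card_le_card_of_injOn (fun s => s + e)
          (fun s hs => ?_) (fun s _ r _ h => add_right_cancel h)
        exact mem_support_iff.2 (hne s hs)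
      rw [length]
      refine (Finset.sum_le_card_nsmul _ _ _ hterm).trans ?_
      rw [nsmul_eq_mul, two_mul, pow_add, mul_assoc]
      have : ((A i j).support.card : ℝ) ≤ 2 ^ S := by exact_mod_cast hcard
      gcongr
    refine (coeff_le_length v _ _).trans ((length_det_le v A hent).trans ?_)
    rw [mul_pow, mul_pow, mul_assoc]
    gcongr
    exact_mod_cast Nat.factorial_le_pow n
  have hnon : ∀ v ∈ nonarchAbsVal (K := K), ∀ s : A.det.support, v (A.det.coeff s.1) ≤
      (⨆ r : P.support, v (P.coeff r.1)) ^ n := by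
    intro v hv s
    have hv' := AdmissibleAbsValues.isNonarchimedean v hv
    refine IsNonarchimedean.coeff_det_le hv' A
      (Real.iSup_nonneg_of_nonnegHomClass v _) (fun i j s => ?_) s
    obtain ⟨e, he⟩ := hA i j
    rw [he, map_mul]
    refine (mul_le_of_le_one_left (v.nonneg _) (IsNonarchimedean.natCast_le_one hv' _)).trans
      (hsup v _)
  have hn' : (0 : ℝ) < n := by exact_mod_cast hn
  have := absHeight_le_of_local (coeffs_ne_zero hdet) (coeffs_ne_zero hP0) n
    (A := ((n : ℝ) * (2 ^ (2 * S))) ^ n) (by positivity) (fun v _ => harch v) hnon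
  refine this.trans (le_of_eq ?_)
  rw [Real.log_pow, Real.log_mul hn'.ne' (by positivity), Real.log_pow, polyHeight]
  push_cast
  ring

end DetHeight

end GenRoth

namespace GenRoth

/-! ### Dividing by a power of a linear factor -/

section LinearFactor

open Polynomial

variable {K : Type*} [Field K]

/-- The coefficients of `(X - ξ) r` are `r_j - ξ r_(j+1)`, so `|ξ| |r_(j+1)|` is at most the size of
such a coefficient plus `|r_j|`. Iterating, with `|ξ| ≥ 1` to raise the power on `|r_j|`, the bounds
add up by Pascal's rule. In the ultrametric version below, the maximum replaces the sum and no
binomial appears. -/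
theorem abv_coeff_mul_pow_le {v : AbsoluteValue K ℝ} {ξ : K} (hξ : 1 ≤ v ξ) {B : ℝ} (l : ℕ)
    (r : K[X]) (hB : ∀ i, v (((X - C ξ) ^ l * r).coeff i) ≤ B) (j : ℕ) :
    v (r.coeff j) * v ξ ^ l ≤ (l + j).choose j * B := by
  induction l generalizing r j with
  | zero => simpa using hB j
  | succ l ih =>
    have ih' := ih ((X - C ξ) * r) (fun i => by rw [← mul_assoc, ← pow_succ]; exact hB i)
    have hpos : (0 : ℝ) < v ξ := by linarith
    induction j with
    | zero =>
      have h := ih' 0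
      rw [mul_coeff_zero, coeff_sub, coeff_X_zero, coeff_C_zero, zero_sub, map_mul, v.map_neg] at h
      simp only [Nat.choose_zero_right, Nat.cast_one, one_mul] at h ⊢
      rw [pow_succ]
      linarith
    | succ j ihj =>
      have h := ih' (j + 1)
      rw [sub_mul, coeff_sub, coeff_X_mul, coeff_C_mul] at h
      have h1 : v ξ * v (r.coeff (j + 1)) ≤ v (r.coeff j - ξ * r.coeff (j + 1)) +
          v (r.coeff j) := by
        have := v.sub_le (r.coeff j - ξ * r.coeff (j + 1)) 0 (r.coeff j)
        simp only [sub_zero, zero_sub, v.map_neg, sub_sub_cancel_left, map_mul] at this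
        exact this
      have h2 : v (r.coeff j) * v ξ ^ l ≤ v (r.coeff j) * v ξ ^ (l + 1) := by
        gcongr
        exact Nat.le_succ l
      have h3 : (((l + 1 + (j + 1)).choose (j + 1) : ℕ) : ℝ) =
          ((l + 1 + j).choose j : ℕ) + ((l + (j + 1)).choose (j + 1) : ℕ) := by
        rw [← Nat.cast_add, show l + 1 + (j + 1) = (l + 1 + j) + 1 by ring, Nat.choose_succ_succ,
          show l + (j + 1) = l + 1 + j by ring]
      have h4 := mul_le_mul_of_nonneg_right h1 (pow_nonneg hpos.le l)
      rw [h3, pow_succ]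
      nlinarith

theorem abv_coeff_mul_pow_le_of_isNonarchimedean {v : AbsoluteValue K ℝ} (hv : IsNonarchimedean v)
    {ξ : K} (hξ : 1 ≤ v ξ) {B : ℝ} (l : ℕ)
    (r : K[X]) (hB : ∀ i, v (((X - C ξ) ^ l * r).coeff i) ≤ B) (j : ℕ) :
    v (r.coeff j) * v ξ ^ l ≤ B := by
  induction l generalizing r j with
  | zero => simpa using hB j
  | succ l ih =>
    have ih' := ih ((X - C ξ) * r) (fun i => by rw [← mul_assoc, ← pow_succ]; exact hB i)
    have hpos : (0 : ℝ) < v ξ := by linarith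
    induction j with
    | zero =>
      have h := ih' 0
      rw [mul_coeff_zero, coeff_sub, coeff_X_zero, coeff_C_zero, zero_sub, map_mul, v.map_neg] at h
      rw [pow_succ]
      linarith
    | succ j ihj =>
      have h := ih' (j + 1)
      rw [sub_mul, coeff_sub, coeff_X_mul, coeff_C_mul] at h
      have h1 : v ξ * v (r.coeff (j + 1)) ≤ max (v (r.coeff j - ξ * r.coeff (j + 1)))
          (v (r.coeff j)) := by
        have := hv (-(r.coeff j - ξ * r.coeff (j + 1))) (r.coeff j)
        rw [v.map_neg, neg_sub, sub_add_cancel, map_mul] at this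
        exact this
      have h2 : v (r.coeff j) * v ξ ^ l ≤ v (r.coeff j) * v ξ ^ (l + 1) := by
        gcongr
        exact Nat.le_succ l
      rw [pow_succ']
      rcases le_max_iff.1 h1 with h3 | h3
      · have := mul_le_mul_of_nonneg_right h3 (pow_nonneg hpos.le l)
        linarith
      · have := mul_le_mul_of_nonneg_right h3 (pow_nonneg hpos.le l)
        linarith

end LinearFactor

/-! ### Multiplicity of a zero against its height -/

section Univariate

open MvPolynomial Height AdmissibleAbsValues

variable {ι K : Type*} [Field K]

theorem coeff_single_aeval_X (j : ι) (p : Polynomial K) (k : ℕ) :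
    coeff (Finsupp.single j k) (Polynomial.aeval (X j : MvPolynomial ι K) p) = p.coeff k := by
  classical
  induction p using Polynomial.induction_on' with
  | add p q hp hq => rw [map_add, coeff_add, hp, hq, Polynomial.coeff_add]
  | monomial n a =>
    rw [Polynomial.aeval_monomial, algebraMap_eq, coeff_C_mul, coeff_X_pow,
      Polynomial.coeff_monomial]
    by_cases h : n = k
    · simp [h]
    · rw [if_neg, if_neg h, mul_zero]
      exact fun h' => h (Finsupp.single_injective j h')

theorem exists_eq_aeval_X [DecidableEq ι] {V : MvPolynomial ι K} {j : ι} {D : ℕ}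
    (hV : DegLE (Pi.single j D) V) : ∃ q : Polynomial K, V = Polynomial.aeval (X j) q := by
  refine ⟨∑ s ∈ V.support, Polynomial.monomial (s j) (coeff s V), ?_⟩
  rw [map_sum]
  conv_lhs => rw [V.as_sum]
  refine Finset.sum_congr rfl fun s hs => ?_
  rw [Polynomial.aeval_monomial, algebraMap_eq, C_mul_X_pow_eq_monomial]
  congr 2
  ext i
  by_cases h : i = j
  · subst h; simp
  · have := hV s (mem_support_iff.1 hs) i
    rw [Pi.single_eq_of_ne h] at this
    rw [Finsupp.single_eq_of_ne h]
    omega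

/-- A univariate polynomial vanishing to high order at `ξ` has large height. -/
theorem order_mul_height_le [Fintype ι] [DecidableEq ι] [NumberField K] {V : MvPolynomial ι K}
    {j : ι} {D : ℕ}
    (hV : DegLE (Pi.single j D) V) (hV0 : V ≠ 0) (ξ : ι → K) {d : ι → ℕ} (hd : 0 < d j) {t : ℝ}
    (ht : translate ξ V ∈ orderIdeal d t) :
    t * (d j * absHeight ![ξ j, 1]) ≤ polyHeight V + D * Real.log 2 := by
  obtain ⟨q, rfl⟩ := exists_eq_aeval_X hV
  have hq0 : q ≠ 0 := by rintro rfl; simp at hV0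
  set T := q.comp (Polynomial.X + Polynomial.C (ξ j)) with hT
  have htr : translate ξ (Polynomial.aeval (X j) q) =
      Polynomial.aeval (X j : MvPolynomial ι K) T := by
    rw [hT, Polynomial.aeval_comp, ← Polynomial.aeval_algHom_apply]
    simp
  set l := q.rootMultiplicity (ξ j) with hl
  have hcl : T.coeff l ≠ 0 := by
    have hT0 : T ≠ 0 := by
      rw [hT]
      exact (Polynomial.comp_X_add_C_ne_zero_iff).2 hq0
    rw [hl, Polynomial.rootMultiplicity_eq_natTrailingDegree, ← hT]
    exact Polynomial.trailingCoeff_nonzero_iff_nonzero.2 hT0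
  have htl : t ≤ l / d j := by
    rw [← weight_single]
    apply ht
    rw [htr, coeff_single_aeval_X]
    exact hcl
  obtain ⟨r, hr⟩ : (Polynomial.X - Polynomial.C (ξ j)) ^ l ∣ q :=
    Polynomial.pow_rootMultiplicity_dvd q (ξ j)
  have hr0 : r ≠ 0 := by rintro rfl; simp at hr; exact hq0 hr
  have hdeg : q.natDegree = l + r.natDegree := by
    rw [hr, Polynomial.natDegree_mul (pow_ne_zero _ (Polynomial.X_sub_C_ne_zero _)) hr0,
      Polynomial.natDegree_pow, Polynomial.natDegree_X_sub_C, mul_one]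
  have hlead : q.leadingCoeff = r.leadingCoeff := by
    rw [hr, Polynomial.leadingCoeff_mul, Polynomial.leadingCoeff_pow,
      Polynomial.leadingCoeff_X_sub_C, one_pow, one_mul]
  have hqD : q.natDegree ≤ D := by
    have := hV (Finsupp.single j q.natDegree) (by
      rw [coeff_single_aeval_X]; exact Polynomial.leadingCoeff_ne_zero.2 hq0) j
    simpa using this
  -- The vector `a (ξ_j^l, 1)` has height `l` times that of `(ξ_j, 1)`. It is compared with the
  -- coefficients of `q` place by place: trivially if `|ξ_j| ≤ 1`, and otherwise by the division
  -- bound applied to the leading coefficient of the cofactor `r`, which is also `a`.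
  set a := q.leadingCoeff with ha
  have ha0 : a ≠ 0 := Polynomial.leadingCoeff_ne_zero.2 hq0
  set V := Polynomial.aeval (X j : MvPolynomial ι K) q with hVdef
  have hsup : ∀ (v : AbsoluteValue K ℝ) (k : ℕ),
      v (q.coeff k) ≤ ⨆ s : V.support, v (V.coeff s.1) := by
    intro v k
    rw [← coeff_single_aeval_X j q k, ← hVdef]
    by_cases hs : Finsupp.single j k ∈ V.support
    · exact Finite.le_ciSup_of_le (⟨_, hs⟩ : V.support) le_rfl
    · rw [notMem_support_iff.1 hs, map_zero]
      exact Real.iSup_nonneg_of_nonnegHomClass v _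
  have hx0 : a • ![ξ j ^ l, 1] ≠ 0 := by
    intro h
    have := congrFun h 1
    simp at this
    exact ha0 this
  have hBnn : ∀ v : AbsoluteValue K ℝ, 0 ≤ ⨆ s : V.support, v (V.coeff s.1) := fun v =>
    Real.iSup_nonneg_of_nonnegHomClass v _
  have hsmall : ∀ v : AbsoluteValue K ℝ, v (ξ j) ≤ 1 →
      v (a * ξ j ^ l) ≤ ⨆ s : V.support, v (V.coeff s.1) := by
    intro v hv
    rw [map_mul, map_pow]
    exact (mul_le_of_le_one_right (v.nonneg _) (pow_le_one₀ (v.nonneg _) hv)).trans (hsup v _)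
  have h2 : ∀ v : AbsoluteValue K ℝ, (⨆ s : V.support, v (V.coeff s.1)) ≤
      2 ^ D * (⨆ s : V.support, v (V.coeff s.1)) := fun v =>
    le_mul_of_one_le_left (hBnn v) (one_le_pow₀ (by norm_num))
  have harch : ∀ v : AbsoluteValue K ℝ, ∀ i, v ((a • ![ξ j ^ l, 1]) i) ≤
      2 ^ D * (⨆ s : V.support, v (V.coeff s.1)) ^ 1 := by
    intro v i
    rw [pow_one]
    fin_cases i
    · simp only [Fin.zero_eta, Pi.smul_apply, Matrix.cons_val_zero, smul_eq_mul]
      rcases le_total (v (ξ j)) 1 with hv | hv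
      · exact (hsmall v hv).trans (h2 v)
      · have := abv_coeff_mul_pow_le hv l r (fun i => by rw [← hr]; exact hsup v i) r.natDegree
        rw [map_mul, map_pow, hlead]
        refine this.trans ?_
        refine mul_le_mul_of_nonneg_right ?_ (hBnn v)
        rw [← hdeg]
        have : q.natDegree.choose r.natDegree ≤ 2 ^ D :=
          (Nat.choose_le_two_pow _ _).trans (Nat.pow_le_pow_right (by norm_num) hqD)
        exact_mod_cast this
    · simp only [Fin.mk_one, Pi.smul_apply, Matrix.cons_val_one, Matrix.cons_val_fin_one,
        smul_eq_mul, mul_one]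
      exact (hsup v _).trans (h2 v)
  have hnon : ∀ v ∈ nonarchAbsVal (K := K), ∀ i, v ((a • ![ξ j ^ l, 1]) i) ≤
      (⨆ s : V.support, v (V.coeff s.1)) ^ 1 := by
    intro v hv' i
    rw [pow_one]
    fin_cases i
    · simp only [Fin.zero_eta, Pi.smul_apply, Matrix.cons_val_zero, smul_eq_mul]
      rcases le_total (v (ξ j)) 1 with hv | hv
      · exact hsmall v hv
      · rw [map_mul, map_pow, hlead]
        exact abv_coeff_mul_pow_le_of_isNonarchimedean
          (AdmissibleAbsValues.isNonarchimedean v hv') hv l r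
          (fun i => by rw [← hr]; exact hsup v i) r.natDegree
    · simp only [Fin.mk_one, Pi.smul_apply, Matrix.cons_val_one, Matrix.cons_val_fin_one,
        smul_eq_mul, mul_one]
      exact hsup v _
  have key := absHeight_le_of_local hx0 (coeffs_ne_zero hV0) 1 (A := 2 ^ D) (by positivity)
    (fun v _ => harch v) hnon
  rw [absHeight_smul _ ha0, Real.log_pow, Nat.cast_one, one_mul, absHeight,
    ← logHeight₁_eq_logHeight, logHeight₁_pow, logHeight₁_eq_logHeight, mul_div_assoc] at key
  have hd' : (0 : ℝ) < d j := by exact_mod_cast hd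
  have h3 : t * d j ≤ l := (le_div_iff₀ hd').1 htl
  have h4 := mul_le_mul_of_nonneg_right h3 (absHeight_nonneg ![ξ j, 1])
  calc t * (d j * absHeight ![ξ j, 1]) = t * d j * absHeight ![ξ j, 1] := by ring
    _ ≤ l * absHeight ![ξ j, 1] := h4
    _ ≤ D * Real.log 2 + polyHeight V := key
    _ = _ := add_comm _ _

end Univariate

end GenRoth

namespace GenRoth

open MvPolynomial

/-! ### Separating one variable -/

section Decomposition

variable {ι K : Type*} [DecidableEq ι] [Field K]

/-- A polynomial is a sum of products of polynomials not involving `X_j` with polynomials in `X_j`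
only, both families being linearly independent. -/
theorem exists_eq_sum_mul {P : MvPolynomial ι K} {D : ι → ℕ} (hP : DegLE D P) (j : ι) :
    ∃ (n : ℕ) (f g : Fin n → MvPolynomial ι K), n ≤ D j + 1 ∧ P = ∑ i, f i * g i ∧
      (∀ i, DegLE (Function.update D j 0) (f i)) ∧ (∀ i, DegLE (Pi.single j (D j)) (g i)) ∧
      LinearIndependent K f ∧ LinearIndependent K g := by
  classical
  let p : Fin (D j + 1) → MvPolynomial ι K := fun c =>
    ∑ s ∈ P.support with s j = (c : ℕ), monomial (s.erase j) (coeff s P)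
  have hPp : P = ∑ c, p c * X j ^ (c : ℕ) := by
    conv_lhs => rw [P.as_sum]
    have hmaps : ∀ s ∈ P.support, (Fin.ofNat (D j + 1) (s j)) ∈
        (Finset.univ : Finset (Fin (D j + 1))) := fun s _ => Finset.mem_univ _
    rw [← Finset.sum_fiberwise_of_maps_to hmaps]
    refine Finset.sum_congr rfl fun c _ => ?_
    simp only [p]
    rw [Finset.sum_mul]
    refine Finset.sum_congr ?_ fun s hs => ?_
    · refine Finset.filter_congr fun s hs => ?_
      have := hP s (mem_support_iff.1 hs) j
      rw [Fin.ext_iff, Fin.val_ofNat, Nat.mod_eq_of_lt (by omega)]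
    · rw [Finset.mem_filter] at hs
      rw [← hs.2, X_pow_eq_monomial, monomial_mul, mul_one, Finsupp.erase_add_single]
  have hpdeg : ∀ c, DegLE (Function.update D j 0) (p c) := by
    intro c
    refine DegLE.sum _ fun s hs => degLE_monomial (fun i => ?_) _
    have hs' := hP s (mem_support_iff.1 (Finset.mem_filter.1 hs).1) i
    by_cases h : i = j
    · subst h; simp
    · rw [Finsupp.erase_ne h, Function.update_of_ne h]; exact hs'
  -- The `f i` form a basis of the span of the `X_j`-coefficients `p c`, drawn from the `p c`
  -- themselves. The `p c` selected as `f i` has delta coordinates, and these give the independence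
  -- of the `g i`.
  obtain ⟨κ, a, ha, hspan, hli⟩ := exists_linearIndependent' K p
  have : Finite κ := Finite.of_injective a ha
  have : Fintype κ := Fintype.ofFinite κ
  let e : Fin (Fintype.card κ) ≃ κ := (Fintype.equivFin κ).symm
  let f : Fin (Fintype.card κ) → MvPolynomial ι K := fun i => p (a (e i))
  have hf : LinearIndependent K f := hli.comp e e.injective
  have hmem : ∀ c, ∃ b : Fin (Fintype.card κ) → K, ∑ i, b i • f i = p c := by
    intro c
    have h1 : p c ∈ Submodule.span K (Set.range (p ∘ a)) := by
      rw [hspan]; exact Submodule.subset_span ⟨c, rfl⟩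
    have h2 : Set.range (p ∘ a) = Set.range f := by
      have : f = (p ∘ a) ∘ e := rfl
      rw [this, e.surjective.range_comp]
    rw [h2, Submodule.mem_span_range_iff_exists_fun] at h1
    exact h1
  choose b hb using hmem
  have hdelta : ∀ i i', b (a (e i')) i = if i = i' then 1 else 0 := by
    intro i i'
    have h1 := hb (a (e i'))
    have h2 : ∑ i, (b (a (e i')) i - if i = i' then 1 else 0) • f i = 0 := by
      simp only [sub_smul, Finset.sum_sub_distrib, h1, ite_smul, one_smul, zero_smul,
        Finset.sum_ite_eq', Finset.mem_univ, if_true, f, sub_self]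
    exact sub_eq_zero.1 (Fintype.linearIndependent_iff.1 hf _ h2 i)
  let g : Fin (Fintype.card κ) → MvPolynomial ι K := fun i =>
    ∑ c : Fin (D j + 1), monomial (Finsupp.single j (c : ℕ)) (b c i)
  refine ⟨Fintype.card κ, f, g, ?_, ?_, fun i => hpdeg _, fun i => ?_, hf, ?_⟩
  · simpa using Fintype.card_le_of_injective a ha
  · rw [hPp]
    simp only [g, Finset.mul_sum]
    rw [Finset.sum_comm]
    refine Finset.sum_congr rfl fun c _ => ?_
    rw [← hb c, Finset.sum_mul]
    refine Finset.sum_congr rfl fun i _ => ?_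
    rw [← C_mul_X_pow_eq_monomial, smul_eq_C_mul]
    ring
  · refine DegLE.sum _ fun c _ => degLE_monomial (fun i => ?_) _
    by_cases h : i = j
    · subst h
      simpa using Nat.lt_succ_iff.1 c.2
    · simp [Finsupp.single_eq_of_ne h]
  · rw [Fintype.linearIndependent_iff]
    intro w hw i'
    have h1 := congrArg (coeff (Finsupp.single j (a (e i') : ℕ))) hw
    have hcoeff : ∀ i, coeff (Finsupp.single j (a (e i') : ℕ)) (g i) = b (a (e i')) i := by
      intro i
      simp only [g, coeff_sum, coeff_monomial]
      rw [Finset.sum_eq_single (a (e i'))]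
      · simp
      · intro c _ hc
        rw [if_neg]
        exact fun h => hc (Fin.ext (Finsupp.single_injective j h))
      · simp
    simpa [coeff_sum, coeff_smul, hcoeff, hdelta] using h1

end Decomposition

/-! ### Numerical inequalities -/

section RealInequalities

/-- Lower bound for the truncated sum of an arithmetic progression. -/
theorem sum_max_sub_div_ge {Θ : ℝ} (hΘ : 0 ≤ Θ) {d n : ℕ} (hd : 0 < d) (hnd : n ≤ d + 1) :
    (n : ℝ) * (min Θ (Θ ^ 2) / 2) ≤ ∑ i : Fin n, max (Θ - (i : ℕ) / d) 0 := by
  rw [Fin.sum_univ_eq_sum_range (fun i : ℕ => max (Θ - (i : ℝ) / d) 0)]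
  have hd' : (0 : ℝ) < d := by exact_mod_cast hd
  have hgauss : ∀ k : ℕ, ∑ i ∈ Finset.range k, (Θ - (i : ℝ) / d) =
      k * Θ - k * (k - 1) / (2 * d) := by
    intro k
    induction k with
    | zero => simp
    | succ k ih =>
      rw [Finset.sum_range_succ, ih]
      push_cast
      field_simp
      ring
  -- In the first case no term is truncated and the full sum is at least `n Θ / 2`. Otherwise only
  -- the terms with `i ≤ Θ d` are kept, giving the quadratic bound.
  by_cases hcase : (n : ℝ) - 1 ≤ Θ * d
  · refine le_trans ?_ (Finset.sum_le_sum fun i _ => le_max_left _ _)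
    rw [hgauss]
    have h1 : (n : ℝ) * (n - 1) / (2 * d) ≤ n * Θ / 2 := by
      rw [div_le_div_iff₀ (by positivity) (by norm_num)]
      have : (n : ℝ) * (n - 1) ≤ n * (Θ * d) := by gcongr
      nlinarith
    have h2 : (n : ℝ) * (min Θ (Θ ^ 2) / 2) ≤ n * (Θ / 2) := by
      gcongr
      exact min_le_left _ _
    linarith
  · rw [not_le] at hcase
    set x := Θ * d with hx
    have hx0 : 0 ≤ x := by positivity
    set N := ⌊x⌋₊ with hN
    have hNx : (N : ℝ) ≤ x := Nat.floor_le hx0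
    have hxN : x < N + 1 := Nat.lt_floor_add_one x
    have hNn : N + 1 < n := by
      have : (N : ℝ) + 1 < n := by linarith
      exact_mod_cast this
    have hNd : (N : ℝ) + 1 ≤ d := by
      have : N + 1 ≤ d := by omega
      exact_mod_cast this
    have hsub : ∑ i ∈ Finset.range (N + 1), (Θ - (i : ℝ) / d) ≤
        ∑ i ∈ Finset.range n, max (Θ - (i : ℝ) / d) 0 :=
      (Finset.sum_le_sum fun i _ => le_max_left _ _).trans
        (Finset.sum_le_sum_of_subset_of_nonneg (Finset.range_mono hNn.le)
          fun i _ _ => le_max_right _ _)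
    refine le_trans ?_ hsub
    rw [hgauss]
    have hn' : (n : ℝ) ≤ d + 1 := by exact_mod_cast hnd
    have hmin : (n : ℝ) * (min Θ (Θ ^ 2) / 2) ≤ (d + 1) * (Θ ^ 2 / 2) := by
      gcongr
      exact min_le_right _ _
    refine hmin.trans ?_
    have hΘx : Θ = x / d := by rw [hx]; field_simp
    -- The product equals `(N+1)² (2x - N) - (N+2) x²`; together with `N + 1 ≤ d` this yields
    -- `hkey`.
    have hfac : 0 ≤ ((N : ℝ) + 1 - x) * ((N + 2) * x - N * (N + 1)) := by
      apply mul_nonneg (by linarith)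
      have hN0 : (0 : ℝ) ≤ N := Nat.cast_nonneg N
      nlinarith
    have hkey : (d + 1) * x ^ 2 ≤ d * ((N + 1) * (2 * x - N)) := by
      have h1 : (N + 2) * x ^ 2 ≤ ((N : ℝ) + 1) ^ 2 * (2 * x - N) := by nlinarith
      have h2 : ((N : ℝ) + 1) * ((d + 1) * x ^ 2) ≤ d * ((N + 2) * x ^ 2) := by
        nlinarith [mul_nonneg (sub_nonneg.2 hNd) (sq_nonneg x)]
      have h3 : (d : ℝ) * ((N + 2) * x ^ 2) ≤ d * (((N : ℝ) + 1) ^ 2 * (2 * x - N)) := by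
        gcongr
      have h4 : (0 : ℝ) < N + 1 := by positivity
      have h5 : ((N : ℝ) + 1) * ((d + 1) * x ^ 2) ≤
          ((N : ℝ) + 1) * (d * ((N + 1) * (2 * x - N))) := by nlinarith
      exact le_of_mul_le_mul_left h5 h4
    rw [hΘx]
    push_cast
    have h6 : ((d : ℝ) + 1) * ((x / d) ^ 2 / 2) = ((d + 1) * x ^ 2) / (2 * d ^ 2) := by
      field_simp
    have h7 : ((N : ℝ) + 1) * (x / d) - (N + 1) * (N + 1 - 1) / (2 * d) =
        (d * ((N + 1) * (2 * x - N))) / (2 * d ^ 2) := by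
      field_simp
      ring
    rw [h6, h7]
    gcongr

/-- The extra `d k` pays for two copies of `d (k + 1)`, which closes the induction; in Roth's lemma
it also absorbs `log n`. -/
theorem sum_geometric_le {d : ℕ → ℕ} {σ : ℝ} (hσ : σ ≤ 1 / 2) {k : ℕ}
    (hdσ : ∀ j, j + 1 < k + 1 → (d (j + 1) : ℝ) ≤ σ * d j) :
    (∑ i ∈ Finset.range (k + 1), (d i : ℝ)) + d k ≤ 2 * d 0 := by
  induction k with
  | zero => simp; linarith
  | succ k ih =>
    rw [Finset.sum_range_succ]
    have h1 := ih fun j hj => hdσ j (by omega)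
    have h2 := hdσ k (by omega)
    have h3 : σ * d k ≤ 1 / 2 * d k := by gcongr
    linarith

theorem antitone_of_ratio {d : ℕ → ℕ} {σ : ℝ} (hσ : σ ≤ 1 / 2) {k : ℕ}
    (hdσ : ∀ j, j + 1 < k → (d (j + 1) : ℝ) ≤ σ * d j) {i j : ℕ} (hij : i ≤ j) (hj : j < k) :
    d j ≤ d i := by
  induction j, hij using Nat.le_induction with
  | base => exact le_rfl
  | succ j hij ih =>
    refine le_trans ?_ (ih (by omega))
    have h2 := hdσ j hj
    have h3 : σ * d j ≤ 1 / 2 * d j := by gcongr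
    have h4 : (0 : ℝ) ≤ d j := Nat.cast_nonneg _
    have : (d (j + 1) : ℝ) ≤ d j := by linarith
    exact_mod_cast this

/-- The final numerical step in the induction for the Roth lemma. -/
theorem le_two_mul_of_min_le {Θ ρ : ℝ} {k : ℕ} (hk : 1 ≤ k) (hΘ : Θ ≤ k)
    (hρ : 0 < ρ) (h : min Θ (Θ ^ 2) ≤ 4 * k * ρ ^ 2) : Θ ≤ 2 * k * ρ := by
  have hk' : (1 : ℝ) ≤ k := by exact_mod_cast hk
  rcases le_total Θ (Θ ^ 2) with h1 | h1
  · rw [min_eq_left h1] at h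
    rcases le_total ρ (1 / 2) with h2 | h2
    · have : (k : ℝ) * ρ * ρ ≤ k * ρ * (1 / 2) := by gcongr
      nlinarith
    · nlinarith
  · rw [min_eq_right h1] at h
    refine (le_abs_self Θ).trans (abs_le_of_sq_le_sq ?_ (by positivity))
    have : (k : ℝ) * ρ ^ 2 * 1 ≤ k * ρ ^ 2 * k := by gcongr
    nlinarith

end RealInequalities

/-! ### Roth's lemma at a point -/

section RothLemma

theorem weight_expo_le {ι : Type*} [Fintype ι] {d : ι → ℕ} {c : ℝ} (l : List ι)
    (hl : ∀ i ∈ l, 1 / (d i : ℝ) ≤ c) : weight d (expo l) ≤ l.length * c := by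
  classical
  induction l with
  | nil => simp [weight]
  | cons i l ih =>
    rw [expo_cons, weight_add, weight_single]
    have h1 := ih fun j hj => hl j (by simp [hj])
    have h2 := hl i (by simp)
    push_cast [List.length_cons]
    linarith

/-- The degrees `d` in the first `k` variables and zero in the others. -/
def truncDeg {N : ℕ} (d : ℕ → ℕ) (k : ℕ) : Fin N → ℕ := fun i => if (i : ℕ) < k then d i else 0

/-- Each active variable contributes at most one to the weight of a monomial. This trivial bound
serves when `σ` is too large for the quadratic estimate to help. -/
theorem order_le_of_degLE {N : ℕ} {K : Type*} [Field K] {d : ℕ → ℕ} (hd : ∀ j, 0 < d j)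
    {k : ℕ} {Q : MvPolynomial (Fin N) K} (hQ : DegLE (truncDeg d k) Q) (hQ0 : Q ≠ 0)
    {t : ℝ} (ht : Q ∈ orderIdeal (fun i : Fin N => d i) t) : t ≤ k := by
  obtain ⟨s, hs⟩ := support_nonempty.2 hQ0
  rw [mem_support_iff] at hs
  refine (ht s hs).trans ?_
  have h1 : ∀ i : Fin N, (s i : ℝ) / (d i : ℝ) ≤ if (i : ℕ) < k then 1 else 0 := by
    intro i
    have h := hQ s hs i
    have hdi : (0 : ℝ) < d i := by exact_mod_cast hd i
    unfold truncDeg at h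
    split_ifs at h ⊢
    · rw [div_le_one hdi]
      exact_mod_cast h
    · simp [Nat.le_zero.1 h]
  refine (Finset.sum_le_sum fun i _ => h1 i).trans ?_
  rw [Finset.sum_boole]
  have : (Finset.univ.filter fun i : Fin N => (i : ℕ) < k).card ≤ (Finset.range k).card :=
    Finset.card_le_card_of_injOn (fun i => (i : ℕ)) (fun i hi => by simpa using hi)
      (fun i _ j _ h => Fin.ext h)
  rw [Finset.card_range] at this
  exact_mod_cast this

theorem sum_truncDeg_le {N : ℕ} (d : ℕ → ℕ) (k : ℕ) :
    ∑ i : Fin N, truncDeg d k i ≤ ∑ i ∈ Finset.range k, d i := by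
  unfold truncDeg
  rw [Fin.sum_univ_eq_sum_range (fun i => if i < k then d i else 0) N, ← Finset.sum_filter]
  exact Finset.sum_le_sum_of_subset fun i hi => by
    rw [Finset.mem_filter] at hi
    exact Finset.mem_range.2 hi.2

/-- Needed because the Wronskian `U` has degrees up to `n * d i`, so the induction hypothesis is
applied with rescaled weights. -/
theorem mem_orderIdeal_mul {ι R : Type*} [Fintype ι] [CommRing R] {d : ι → ℕ} {t : ℝ}
    {f : MvPolynomial ι R} (hf : f ∈ orderIdeal d t) {n : ℕ} (hn : 0 < n) :
    f ∈ orderIdeal (fun i => n * d i) (t / n) := by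
  intro s hs
  have hn' : (0 : ℝ) < n := by exact_mod_cast hn
  have : weight (fun i => n * d i) s = weight d s / n := by
    rw [weight, weight, Finset.sum_div]
    refine Finset.sum_congr rfl fun i _ => ?_
    push_cast
    rw [div_div, mul_comm]
  rw [this]
  exact div_le_div_of_nonneg_right (hf s hs) hn'.le

variable {K : Type*} [Field K] [NumberField K]

/-- The Wronskian construction: from a polynomial `P` one obtains polynomials `U`, not involving
the variable `X_j`, and `V`, involving only `X_j`, such that the height of `U * V` is controlled
by that of `P`, and its weighted order by that of `P`. -/
theorem exists_wronskian {ι : Type*} [Fintype ι] [LinearOrder ι] {P : MvPolynomial ι K}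
    {D : ι → ℕ} (hP : DegLE D P) (hP0 : P ≠ 0) (j : ι) {d : ι → ℕ} (hd : 0 < d j)
    (hDj : D j ≤ d j) {σ : ℝ} (hσ : 0 ≤ σ)
    (hdσ : ∀ i, i ≠ j → D i ≠ 0 → (d j : ℝ) * (1 / d i) ≤ σ) (ξ : ι → K) {t : ℝ} (ht0 : 0 ≤ t)
    (ht : translate ξ P ∈ orderIdeal d t) :
    ∃ (n : ℕ) (U V : MvPolynomial ι K), 0 < n ∧ n ≤ D j + 1 ∧ U ≠ 0 ∧ V ≠ 0 ∧
      DegLE (n • Function.update D j 0) U ∧ DegLE (Pi.single j (n * D j)) V ∧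
      polyHeight U + polyHeight V ≤
        n * (polyHeight P + Real.log n + 2 * (∑ i, D i : ℕ) * Real.log 2) ∧
      translate ξ (U * V) ∈ orderIdeal d (n * (min t (t ^ 2) / 2 - σ)) := by
  classical
  obtain ⟨n, f, g, hn, hPfg, hfD, hgD, hf, hg⟩ := exists_eq_sum_mul hP j
  obtain ⟨l, hl, hdetf⟩ := exists_derivs_det_ne_zero n f hf
  obtain ⟨l', hl', hdetg⟩ := exists_derivs_det_ne_zero n g hg
  set A := Matrix.of fun i c => derivs (l i) (f c) with hA
  set B := Matrix.of fun i c => derivs (l' i) (g c) with hB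
  -- A derivative in a variable absent from the family would produce a zero row, so nonvanishing
  -- dictates which variables the lists contain.
  have hlmem : ∀ i, ∀ a ∈ l i, a ≠ j ∧ D a ≠ 0 := by
    intro i a ha
    by_contra hcon
    refine hdetf (Matrix.det_eq_zero_of_row_eq_zero i fun c => ?_)
    refine derivs_eq_zero_of_mem (hfD c) ha ?_
    by_cases h : a = j
    · subst h; simp
    · rw [Function.update_of_ne h]
      by_contra h'
      exact hcon ⟨h, h'⟩
  have hlmem' : ∀ i, ∀ a ∈ l' i, a = j := by
    intro i a ha
    by_contra hcon
    refine hdetg (Matrix.det_eq_zero_of_row_eq_zero i fun c => ?_)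
    exact derivs_eq_zero_of_mem (hgD c) ha (Pi.single_eq_of_ne hcon _)
  have hn0 : 0 < n := by
    rcases Nat.eq_zero_or_pos n with rfl | h
    · exact absurd (by rw [hPfg]; simp) hP0
    · exact h
  set W := Matrix.of fun i c => derivs (l i ++ l' c) P with hW
  have hWAB : W = A * B.transpose := by
    ext1 i c
    rw [hW, Matrix.of_apply, Matrix.mul_apply, derivs_append, hPfg, derivs_sum, derivs_sum]
    refine Finset.sum_congr rfl fun a _ => ?_
    rw [hA, hB, Matrix.transpose_apply, Matrix.of_apply, Matrix.of_apply, mul_comm (f a),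
      derivs_mul_of_disjoint (hfD a) _ (fun b hb => by rw [hlmem' c b hb]; simp), mul_comm,
      derivs_mul_of_disjoint ((hgD a).derivs _) _
        (fun b hb => Pi.single_eq_of_ne (hlmem i b hb).1 _)]
  have hdetW : W.det = A.det * B.det := by
    rw [hWAB, Matrix.det_mul, Matrix.det_transpose]
  have hUdeg : DegLE (n • Function.update D j 0) A.det :=
    DegLE.det fun i c => (hfD c).derivs (l i)
  have hVdeg : DegLE (Pi.single j (n * D j)) B.det := by
    refine (DegLE.det fun i c => (hgD c).derivs (l' i)).mono fun i => ?_
    by_cases h : i = j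
    · subst h; simp
    · simp [Pi.single_eq_of_ne h]
  have hdisj : ∀ i, (n • Function.update D j 0) i = 0 ∨
      (Pi.single j (n * D j) : ι → ℕ) i = 0 := by
    intro i
    by_cases h : i = j
    · subst h; simp
    · exact Or.inr (Pi.single_eq_of_ne h _)
  refine ⟨n, A.det, B.det, hn0, hn, hdetf, hdetg, hUdeg, hVdeg, ?_, ?_⟩
  · refine (polyHeight_add_le_of_disjoint hUdeg hVdeg hdisj hdetf hdetg).trans ?_
    rw [← hdetW]
    have hfac : ∀ L : List ι, ((∏ i, (expo L i).factorial : ℕ) : K) ≠ 0 := fun L =>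
      Nat.cast_ne_zero.2 (Finset.prod_ne_zero_iff.2 fun i _ => Nat.factorial_ne_zero _)
    let a : Fin n → K := fun i => ((∏ b, (expo (l i) b).factorial : ℕ) : K)⁻¹
    let a' : Fin n → K := fun i => ((∏ b, (expo (l' i) b).factorial : ℕ) : K)⁻¹
    let E : Matrix (Fin n) (Fin n) (MvPolynomial ι K) :=
      Matrix.of fun i c => C (a' c) * (Matrix.of fun i c => C (a i) * W i c) i c
    have hEdet : E.det = ((∏ c, a' c) * ∏ i, a i) • W.det := by
      rw [Matrix.det_mul_row, Matrix.det_mul_column, smul_eq_C_mul, map_mul, map_prod, map_prod,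
        mul_assoc]
    have hscal : (∏ c, a' c) * ∏ i, a i ≠ 0 :=
      mul_ne_zero (Finset.prod_ne_zero_iff.2 fun i _ => inv_ne_zero (hfac _))
        (Finset.prod_ne_zero_iff.2 fun i _ => inv_ne_zero (hfac _))
    refine (polyHeight_smul_le W.det hscal).trans ?_
    rw [← hEdet]
    refine polyHeight_det_le hP hP0 ?_ fun i c => ⟨expo (l i ++ l' c), fun s => ?_⟩
    · rw [hEdet, hdetW]
      exact smul_ne_zero hscal (mul_ne_zero hdetf hdetg)
    -- The lists `l i` and `l' c` share no variable, so the factorials split into a row factor and a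
    -- column factor, cancelled by `a` and `a'`.
    · have hsplit : (∏ b, (expo (l i ++ l' c) b).factorial) =
          (∏ b, (expo (l i) b).factorial) * ∏ b, (expo (l' c) b).factorial := by
        rw [← Finset.prod_mul_distrib]
        refine Finset.prod_congr rfl fun b _ => ?_
        rw [expo_append, Finsupp.add_apply]
        by_cases h : b = j
        · have : expo (l i) b = 0 := expo_apply_eq_zero fun hb => (hlmem i b hb).1 h
          rw [this]; simp
        · have : expo (l' c) b = 0 := expo_apply_eq_zero fun hb => h (hlmem' c b hb)
          rw [this]; simp
      simp only [E, hW, Matrix.of_apply, coeff_C_mul]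
      rw [coeff_derivs, hsplit]
      have h1 := hfac (l i)
      have h2 := hfac (l' c)
      simp only [a, a']
      rw [Nat.cast_mul]
      field_simp
  · rw [← hdetW]
    -- Differentiating along `l i` costs at most `σ`: at most `n - 1 ≤ d j` derivatives, each
    -- costing at most `σ / d j`. Differentiating along `l' c` costs at most `c / d j`.
    have hent : ∀ i c : Fin n, (Matrix.of fun i c => translate ξ (W i c)) i c ∈
        orderIdeal d (max (t - σ - ((c : ℕ) : ℝ) / d j) 0) := by
      intro i c
      rcases le_total (t - σ - ((c : ℕ) : ℝ) / d j) 0 with h | h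
      · rw [max_eq_right h]
        exact mem_orderIdeal_of_nonpos d le_rfl _
      · rw [max_eq_left h, Matrix.of_apply, hW, Matrix.of_apply, ← derivs_translate]
        refine orderIdeal_anti d ?_ (derivs_mem_orderIdeal ht _)
        rw [expo_append, weight_add]
        have hd' : (0 : ℝ) < d j := by exact_mod_cast hd
        have h1 : weight d (expo (l' c)) ≤ ((c : ℕ) : ℝ) / d j := by
          refine (weight_expo_le (l' c) (c := 1 / d j) fun a ha => by rw [hlmem' c a ha]).trans ?_
          rw [mul_one_div]
          have : ((l' c).length : ℝ) ≤ (c : ℕ) := by exact_mod_cast hl' c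
          gcongr
        have h2 : weight d (expo (l i)) ≤ σ := by
          have h3 : ∀ a ∈ l i, 1 / (d a : ℝ) ≤ σ / d j := fun a ha => by
            rw [le_div_iff₀ hd', mul_comm]
            exact hdσ a (hlmem i a ha).1 (hlmem i a ha).2
          refine (weight_expo_le (l i) h3).trans ?_
          have h4 : ((l i).length : ℝ) ≤ d j := by
            have := hl i
            have := i.2
            exact_mod_cast (by omega : (l i).length ≤ d j)
          rw [mul_div_assoc', div_le_iff₀ hd', mul_comm]
          gcongr
        linarith
    have hmem := det_mem_orderIdeal hent
    have hdet : (Matrix.of fun i c => translate ξ (W i c)).det = translate ξ W.det := by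
      rw [AlgHom.map_det]
      rfl
    rw [hdet] at hmem
    refine orderIdeal_anti d ?_ hmem
    have h1 := sum_max_sub_div_ge ht0 hd (hn.trans (Nat.add_le_add_right hDj 1))
    have h2 : ∑ i : Fin n, max (t - ((i : ℕ) : ℝ) / d j) 0 ≤
        ∑ i : Fin n, (max (t - σ - ((i : ℕ) : ℝ) / d j) 0 + σ) := by
      refine Finset.sum_le_sum fun i _ => max_le ?_ ?_
      · have := le_max_left (t - σ - ((i : ℕ) : ℝ) / d j) 0
        linarith
      · have := le_max_right (t - σ - ((i : ℕ) : ℝ) / d j) 0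
        linarith
    rw [Finset.sum_add_distrib, Finset.sum_const, Finset.card_univ, Fintype.card_fin,
      nsmul_eq_mul] at h2
    linarith

/-- **Roth's lemma** for polynomials in the first `k` of `N` variables. -/
theorem roth_lemma {N : ℕ} {σ : ℝ} (hσ0 : 0 < σ) (hσ : σ ≤ 1 / 2) (ξ : Fin N → K) (k : ℕ)
    (hkN : k + 1 ≤ N) (d : ℕ → ℕ) (hd : ∀ j, 0 < d j)
    (hdσ : ∀ j, j + 1 < k + 1 → (d (j + 1) : ℝ) ≤ σ * d j)
    {P : MvPolynomial (Fin N) K} (hP0 : P ≠ 0) (hP : DegLE (truncDeg d (k + 1)) P)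
    (hheight : ∀ j : Fin N, (j : ℕ) < k + 1 →
      σ⁻¹ * (polyHeight P + 4 * (k + 1) * d 0) ≤ d j * absHeight ![ξ j, 1])
    {t : ℝ} (ht : translate ξ P ∈ orderIdeal (fun i : Fin N => d i) t) :
    t ≤ 2 * (k + 1) * σ ^ ((1 : ℝ) / 2 ^ k) := by
  have hlog2 : Real.log 2 ≤ 0.7 := by have := Real.log_two_lt_d9; linarith
  have hlog0 : 0 ≤ Real.log 2 := Real.log_nonneg (by norm_num)
  -- The ambient ring in `N` variables stays fixed; only the number of active variables drops, while
  -- the degrees change to `n * d`.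
  induction k generalizing d P t with
  | zero =>
    have hj : 0 < N := hkN
    have hdeg : DegLE (Pi.single (⟨0, hj⟩ : Fin N) (d 0)) P := by
      refine hP.mono fun i => ?_
      unfold truncDeg
      by_cases h : i = ⟨0, hj⟩
      · subst h; simp
      · rw [if_neg]
        · simp
        · intro h'
          exact h (Fin.ext (by simpa using h'))
    have h1 := order_mul_height_le hdeg hP0 ξ (d := fun i : Fin N => d i) (hd 0) ht
    have h2 := hheight ⟨0, hj⟩ (by simp)
    have hd0 : (0 : ℝ) < d 0 := by exact_mod_cast hd 0
    have hh := polyHeight_nonneg P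
    simp only [CharP.cast_eq_zero, zero_add, pow_zero, div_one, Real.rpow_one, mul_one] at h1 h2 ⊢
    by_contra hcon
    rw [not_le] at hcon
    have h3 : σ * (σ⁻¹ * (polyHeight P + 4 * d 0)) ≤ t * (d 0 * absHeight ![ξ ⟨0, hj⟩, 1]) := by
      have : 0 ≤ σ⁻¹ * (polyHeight P + 4 * d 0) := by positivity
      exact mul_le_mul (by linarith) h2 this (by linarith)
    rw [mul_inv_cancel_left₀ hσ0.ne'] at h3
    nlinarith
  | succ κ ih =>
    rcases lt_or_ge t 0 with htneg | ht0
    · exact htneg.le.trans (by positivity)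
    have hjN : κ + 1 < N := hkN
    set j : Fin N := ⟨κ + 1, hjN⟩ with hj
    have hDj : truncDeg d (κ + 1 + 1) j = d (κ + 1) := by simp [truncDeg, hj]
    have hratio : ∀ i : Fin N, i ≠ j → truncDeg d (κ + 1 + 1) i ≠ 0 →
        (d j : ℝ) * (1 / d i) ≤ σ := by
      intro i hij hi
      have hilt : (i : ℕ) < κ + 1 := by
        have h1 : (i : ℕ) < κ + 1 + 1 := by
          by_contra h
          exact hi (if_neg h)
        have h2 : (i : ℕ) ≠ κ + 1 := fun h => hij (Fin.ext h)
        omega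
      have hdi : (0 : ℝ) < d i := by exact_mod_cast hd i
      rw [mul_one_div, div_le_iff₀ hdi]
      refine (hdσ κ (by omega)).trans ?_
      have : d κ ≤ d i := antitone_of_ratio hσ hdσ (Nat.lt_succ_iff.1 hilt) (by omega)
      gcongr
    obtain ⟨n, U, V, hn0, hn, hU0, hV0, hUD, hVD, hUV, hmem⟩ :=
      exists_wronskian hP hP0 j (d := fun i : Fin N => d i) (hd _) hDj.le hσ0.le hratio ξ ht0 ht
    rw [hDj] at hn hVD
    have hn' : (0 : ℝ) < n := by exact_mod_cast hn0
    have hd0 : (0 : ℝ) < d 0 := by exact_mod_cast hd 0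
    have hh := polyHeight_nonneg P
    have hhU := polyHeight_nonneg U
    have hhV := polyHeight_nonneg V
    have hUD' : DegLE (truncDeg (fun i => n * d i) (κ + 1)) U := by
      refine hUD.mono fun i => ?_
      rw [Pi.smul_apply, smul_eq_mul]
      by_cases h : i = j
      · subst h; simp
      · rw [Function.update_of_ne h]
        unfold truncDeg
        have h2 : (i : ℕ) ≠ κ + 1 := fun h' => h (Fin.ext h')
        split_ifs <;> first | omega | simp
    have hdisj : ∀ i, (n • Function.update (truncDeg d (κ + 1 + 1)) j 0) i = 0 ∨
        (Pi.single j (n * d (κ + 1)) : Fin N → ℕ) i = 0 := by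
      intro i
      by_cases h : i = j
      · subst h; simp
      · exact Or.inr (Pi.single_eq_of_ne h _)
    rw [map_mul] at hmem
    obtain ⟨tU, tV, htUV, htU, htV⟩ := exists_orderIdeal_of_mul_mem (hUD.translate ξ)
      (hVD.translate ξ) hdisj (translate_ne_zero ξ hU0) (translate_ne_zero ξ hV0) hmem
    have hdj0 : (d (κ + 1) : ℝ) ≤ d 0 := by
      exact_mod_cast antitone_of_ratio hσ hdσ (Nat.zero_le (κ + 1)) (by omega)
    -- Here `2.8 = 4 * 0.7`, with `0.7` bounding `log 2`. It is below `4`, so each induction step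
    -- uses up at most one summand `4 * d 0` of the height hypothesis.
    have hbound : polyHeight U + polyHeight V ≤ n * (polyHeight P + 2.8 * d 0) := by
      refine hUV.trans ?_
      have hS : ((∑ i : Fin N, truncDeg d (κ + 1 + 1) i : ℕ) : ℝ) + d (κ + 1) ≤ 2 * d 0 := by
        refine le_trans ?_ (sum_geometric_le hσ hdσ)
        have := sum_truncDeg_le (N := N) d (κ + 1 + 1)
        gcongr
        exact_mod_cast this
      have hlogn : Real.log n ≤ d (κ + 1) * Real.log 2 := by
        rw [← Real.log_pow]
        refine Real.log_le_log hn' ?_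
        have : n ≤ 2 ^ d (κ + 1) := hn.trans Nat.lt_two_pow_self
        exact_mod_cast this
      have h1 : ((d (κ + 1) : ℝ) + 2 * (∑ i : Fin N, truncDeg d (κ + 1 + 1) i : ℕ)) *
          Real.log 2 ≤ 4 * d 0 * 0.7 := by
        refine mul_le_mul ?_ hlog2 hlog0 (by positivity)
        have : (0 : ℝ) ≤ d (κ + 1) := Nat.cast_nonneg _
        linarith
      refine mul_le_mul_of_nonneg_left ?_ hn'.le
      linarith
    have hheight' : ∀ i : Fin N, (i : ℕ) < κ + 1 + 1 →
        σ⁻¹ * (polyHeight P + 4 * (κ + 2) * d 0) ≤ d i * absHeight ![ξ i, 1] := by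
      intro i hi
      refine le_trans (le_of_eq ?_) (hheight i hi)
      push_cast
      ring
    have hκ : (0 : ℝ) ≤ κ := Nat.cast_nonneg κ
    have hU : tU / n ≤ 2 * (κ + 1) * σ ^ ((1 : ℝ) / 2 ^ κ) := by
      refine ih (by omega) (fun i => n * d i) (fun i => Nat.mul_pos hn0 (hd i)) ?_ hU0 hUD' ?_
        (mem_orderIdeal_mul htU hn0)
      · intro i hi
        have := hdσ i (by omega)
        push_cast
        calc (n : ℝ) * d (i + 1) ≤ n * (σ * d i) := by gcongr
          _ = σ * (n * d i) := by ring
      · intro i hi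
        have h1 := hheight' i (by omega)
        push_cast
        calc σ⁻¹ * (polyHeight U + 4 * (κ + 1) * (n * d 0))
            ≤ σ⁻¹ * (n * (polyHeight P + 2.8 * d 0) + 4 * (κ + 1) * (n * d 0)) := by
              gcongr
              linarith
          _ ≤ n * (σ⁻¹ * (polyHeight P + 4 * (κ + 2) * d 0)) := by
              have : n * (σ⁻¹ * (polyHeight P + 4 * (κ + 2) * d 0)) =
                σ⁻¹ * (n * (polyHeight P + 4 * (κ + 2) * d 0)) := by ring
              rw [this]
              refine mul_le_mul_of_nonneg_left ?_ (inv_nonneg.2 hσ0.le)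
              have : (0 : ℝ) ≤ n * d 0 := by positivity
              nlinarith
          _ ≤ n * (d i * absHeight ![ξ i, 1]) := by gcongr
          _ = n * d i * absHeight ![ξ i, 1] := by ring
    -- A larger order would force the height of `V` plus `n * d (κ + 1) * log 2` up to `n (h(P) + 4
    -- (κ + 2) d 0)`, whereas it is at most `n (h(P) + 3.5 d 0)`.
    have hV : tV ≤ n * σ := by
      have h1 := order_mul_height_le hVD hV0 ξ (d := fun i : Fin N => d i) (hd _) htV
      have h2 := hheight' j (by simp [hj])
      by_contra hcon
      rw [not_le] at hcon
      have h3 : n * σ * (σ⁻¹ * (polyHeight P + 4 * (κ + 2) * d 0)) ≤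
          tV * (d j * absHeight ![ξ j, 1]) := by
        have : 0 ≤ σ⁻¹ * (polyHeight P + 4 * (κ + 2) * d 0) := by positivity
        exact mul_le_mul hcon.le h2 this (le_trans (by positivity) hcon.le)
      rw [mul_assoc, mul_inv_cancel_left₀ hσ0.ne'] at h3
      have h4 : ((n * d (κ + 1) : ℕ) : ℝ) * Real.log 2 ≤ n * d 0 * 0.7 := by
        push_cast
        gcongr
      have h5 : (0 : ℝ) < n * d 0 := by positivity
      have h6 : 0 ≤ κ * ((n : ℝ) * d 0) := by positivity
      nlinarith
    have hρ : 0 < σ ^ ((1 : ℝ) / 2 ^ (κ + 1)) := Real.rpow_pos_of_pos hσ0 _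
    have hρ2 : (σ ^ ((1 : ℝ) / 2 ^ (κ + 1))) ^ 2 = σ ^ ((1 : ℝ) / 2 ^ κ) := by
      rw [← Real.rpow_natCast, ← Real.rpow_mul hσ0.le]
      congr 1
      push_cast
      field_simp
      ring
    have hστ : σ ≤ σ ^ ((1 : ℝ) / 2 ^ κ) := by
      conv_lhs => rw [← Real.rpow_one σ]
      refine Real.rpow_le_rpow_of_exponent_ge hσ0 (by linarith) ?_
      rw [div_le_one (by positivity)]
      exact one_le_pow₀ (by norm_num)
    have hfin : min t (t ^ 2) ≤ 4 * (κ + 2 : ℕ) * (σ ^ ((1 : ℝ) / 2 ^ (κ + 1))) ^ 2 := by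
      rw [hρ2]
      set τ := σ ^ ((1 : ℝ) / 2 ^ κ)
      rw [div_le_iff₀ hn'] at hU
      have h1 : n * (min t (t ^ 2) / 2 - σ) ≤ n * (2 * (κ + 1) * τ + σ) := by linarith
      have h2 := le_of_mul_le_mul_left h1 hn'
      push_cast
      linarith
    have htk := order_le_of_degLE hd (hP.translate ξ) (translate_ne_zero ξ hP0) ht
    have := le_two_mul_of_min_le (k := κ + 2) (by omega) (by exact_mod_cast htk) hρ hfin
    refine this.trans (le_of_eq ?_)
    push_cast
    ring

end RothLemma

/-! ### Reduction from linear forms to a point -/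

section Reduction

open Height in
/-- The height of a vector is controlled by the heights of the ratios of its coordinates. -/
theorem exists_ratio_height {K : Type*} [Field K] [NumberField K] {n : ℕ} (hn : 1 ≤ n)
    {b : Fin (n + 1) → K} (hb : b ≠ 0) : ∃ i₀ i₁, i₁ ≠ i₀ ∧ b i₀ ≠ 0 ∧
      absHeight b ≤ n * absHeight ![-(b i₁) / b i₀, 1] := by
  classical
  obtain ⟨i₀, hi₀⟩ := Function.ne_iff.1 hb
  rw [Pi.zero_apply] at hi₀
  let x : {i // i ≠ i₀} → Fin 2 → K := fun a => ![b a.1 / b i₀, 1]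
  have hx : ∀ a, x a ≠ 0 := fun a h => by
    have := congrFun h 1
    simp [x] at this
  let I : Fin (n + 1) → {i // i ≠ i₀} → Fin 2 := fun i a => if a.1 = i then 0 else 1
  -- The normalized vector is a subvector of the tensor product of the `n` vectors `(b_a / b_{i₀},
  -- 1)`, so its height is at most the sum of theirs; the largest of these provides `i₁`.
  have hcomp : (b i₀)⁻¹ • b = (fun J : {i // i ≠ i₀} → Fin 2 => ∏ a, x a (J a)) ∘ I := by
    funext i
    simp only [Pi.smul_apply, smul_eq_mul, Function.comp_apply, I]
    have hval : ∀ a : {i // i ≠ i₀}, x a (if a.1 = i then 0 else 1) =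
        if a.1 = i then b i / b i₀ else 1 := by
      intro a
      split_ifs with h
      · simp [x, h]
      · simp [x]
    rw [Finset.prod_congr rfl fun a _ => hval a]
    by_cases h : i = i₀
    · subst h
      rw [Finset.prod_eq_one fun a _ => if_neg a.2, inv_mul_cancel₀ hi₀]
    · rw [Finset.prod_eq_single (⟨i, h⟩ : {i // i ≠ i₀})]
      · rw [if_pos rfl, div_eq_inv_mul]
      · intro a _ ha
        exact if_neg fun h' => ha (Subtype.ext h')
      · simp
  have hle : absHeight b ≤ ∑ a, absHeight (x a) := by
    rw [← absHeight_smul b (inv_ne_zero hi₀), hcomp]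
    refine (absHeight_comp_le I _).trans (le_of_eq ?_)
    rw [absHeight, logHeight_fun_prod_eq hx, Finset.sum_div]
    rfl
  have hcard : Fintype.card {i // i ≠ i₀} = n := by
    rw [Fintype.card_subtype_compl]; simp
  have hne : (Finset.univ : Finset {i // i ≠ i₀}).Nonempty := by
    rw [← Finset.card_pos, Finset.card_univ, hcard]
    omega
  obtain ⟨a, _, ha⟩ := Finset.exists_max_image _ (fun a => absHeight (x a)) hne
  refine ⟨i₀, a.1, a.2, hi₀, hle.trans ?_⟩
  have h1 := Finset.sum_le_card_nsmul _ _ _ ha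
  rw [Finset.card_univ, hcard, nsmul_eq_mul] at h1
  refine h1.trans (le_of_eq ?_)
  simp only [x, absHeight]
  rw [neg_div, ← logHeight₁_eq_logHeight, ← logHeight₁_eq_logHeight, logHeight₁_neg]

variable {m n : ℕ} (i₀ i₁ : Fin m → Fin (n + 1))

/-- The part of an exponent in the variables other than the two distinguished ones of each
block. -/
noncomputable def otherPart (s : Fin m × Fin (n + 1) →₀ ℕ) : Fin m × Fin (n + 1) →₀ ℕ :=
  s.filter fun p => p.2 ≠ i₀ p.1 ∧ p.2 ≠ i₁ p.1

/-- The exponents of the first distinguished variables of the blocks. -/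
noncomputable def mainPart (s : Fin m × Fin (n + 1) →₀ ℕ) : Fin m →₀ ℕ :=
  Finsupp.equivFunOnFinite.symm fun h => s (h, i₀ h)

/-- The part of `P` of exponent `e` in the other variables, with the second distinguished variable
of each block set equal to `1`. -/
noncomputable def slice {F : Type*} [Field F] (e : Fin m × Fin (n + 1) →₀ ℕ)
    (P : MvPolynomial (Fin m × Fin (n + 1)) F) : MvPolynomial (Fin m) F :=
  ∑ s ∈ P.support with otherPart i₀ i₁ s = e, monomial (mainPart i₀ s) (coeff s P)

variable {F : Type*} [Field F]

/-- The images of the variables under the substitution that turns the `h`-th linear form into a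
multiple of the `h`-th variable of the coefficient ring. -/
noncomputable def substVar (M : Fin m → Fin (n + 1) → F) (p : Fin m × Fin (n + 1)) :
    MvPolynomial (Fin m × Fin (n + 1)) (MvPolynomial (Fin m) F) :=
  (if p.2 = i₀ p.1 then
    C (X p.1 + C (-(M p.1 (i₁ p.1)) / M p.1 (i₀ p.1))) -
      ∑ i with i ≠ i₀ p.1 ∧ i ≠ i₁ p.1, C (C (M p.1 i / M p.1 (i₀ p.1))) * X (p.1, i)
    else 1) * (if p.2 ≠ i₀ p.1 ∧ p.2 ≠ i₁ p.1 then X p else 1)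

variable {i₀ i₁}

theorem aeval_substVar_linForm {M : Fin m → Fin (n + 1) → F} (h01 : ∀ h, i₁ h ≠ i₀ h)
    (hM : ∀ h, M h (i₀ h) ≠ 0) (h : Fin m) :
    aeval (substVar i₀ i₁ M) (linForm (M h) h) = C (C (M h (i₀ h)) * X h) := by
  classical
  have hval : ∀ i, aeval (substVar i₀ i₁ M) (C (M h i) * X (h, i)) =
      C (C (M h i)) * substVar i₀ i₁ M (h, i) := by
    intro i
    rw [map_mul, aeval_X, aeval_C]
    rfl
  rw [linForm, map_sum, Finset.sum_congr rfl fun i _ => hval i,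
    ← Finset.add_sum_erase _ _ (Finset.mem_univ (i₀ h)),
    ← Finset.add_sum_erase _ _ (Finset.mem_erase.2 ⟨h01 h, Finset.mem_univ (i₁ h)⟩)]
  have hset : (Finset.univ.erase (i₀ h)).erase (i₁ h) =
      Finset.univ.filter fun i => i ≠ i₀ h ∧ i ≠ i₁ h := by
    ext i
    simp [and_comm]
  have hothers : ∑ i ∈ (Finset.univ.erase (i₀ h)).erase (i₁ h),
      C (C (M h i)) * substVar i₀ i₁ M (h, i) =
      ∑ i with i ≠ i₀ h ∧ i ≠ i₁ h, C (C (M h (i₀ h))) *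
        (C (C (M h i / M h (i₀ h))) * X (h, i)) := by
    rw [hset]
    refine Finset.sum_congr rfl fun i hi => ?_
    have hi' := (Finset.mem_filter.1 hi).2
    rw [substVar, if_neg hi'.1, if_pos hi', one_mul, ← mul_assoc, ← C_mul, ← C_mul,
      mul_div_cancel₀ _ (hM h)]
  have h0 : substVar i₀ i₁ M (h, i₀ h) = C (X h + C (-(M h (i₁ h)) / M h (i₀ h))) -
      ∑ i with i ≠ i₀ h ∧ i ≠ i₁ h, C (C (M h i / M h (i₀ h))) * X (h, i) := by
    rw [substVar, if_pos rfl, if_neg (fun h' => h'.1 rfl), mul_one]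
  have h1 : substVar i₀ i₁ M (h, i₁ h) = 1 := by
    rw [substVar, if_neg (h01 h), if_neg (fun h' => h'.2 rfl), mul_one]
  rw [hothers, h0, h1, ← Finset.mul_sum]
  have h2 : (C (C (M h (i₀ h))) : MvPolynomial (Fin m × Fin (n + 1)) (MvPolynomial (Fin m) F)) *
      C (C (-(M h (i₁ h)) / M h (i₀ h))) = - C (C (M h (i₁ h))) := by
    rw [← C_mul, ← C_mul, mul_div_cancel₀ _ (hM h), C_neg, C_neg]
  rw [C_add, C_mul]
  linear_combination h2

/-- The generators of the index ideal become constant multiples of monomials in the `Y_h` of weight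
at least `t`. -/
theorem aeval_substVar_mem {M : Fin m → Fin (n + 1) → F} (h01 : ∀ h, i₁ h ≠ i₀ h)
    (hM : ∀ h, M h (i₀ h) ≠ 0) {d : Fin m → ℕ} {t : ℝ}
    {P : MvPolynomial (Fin m × Fin (n + 1)) F} (hP : P ∈ indexIdeal t d M) :
    aeval (substVar i₀ i₁ M) P ∈ Ideal.map C (orderIdeal d t : Ideal (MvPolynomial (Fin m) F)) := by
  classical
  suffices h : indexIdeal t d M ≤ Ideal.comap (aeval (substVar i₀ i₁ M))
      (Ideal.map C (orderIdeal d t : Ideal (MvPolynomial (Fin m) F))) from h hP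
  rw [indexIdeal, Ideal.span_le]
  rintro f ⟨J, hJ, rfl⟩
  rw [SetLike.mem_coe, Ideal.mem_comap, map_prod]
  simp only [map_pow, aeval_substVar_linForm h01 hM]
  simp only [← map_pow, ← map_prod]
  refine Ideal.mem_map_of_mem C (orderIdeal_anti d hJ (prod_mem_orderIdeal _ fun h _ => ?_))
  rw [C_mul_X_eq_monomial, monomial_pow]
  intro s hs
  rw [coeff_monomial] at hs
  split_ifs at hs with hs'
  · rw [← hs', Finsupp.smul_single, weight_single]
    simp
  · exact absurd rfl hs

/-- The image of a monomial `s` is divisible by its part in the other variables, so only `s` with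
`otherPart s ≤ e` can contribute at `e`. By `he` these have `otherPart s = e`, and then only the
constant term of the cofactor matters, a product of powers of `Y_h + ξ_h`. -/
theorem coeff_aeval_substVar (M : Fin m → Fin (n + 1) → F)
    {P : MvPolynomial (Fin m × Fin (n + 1)) F} {e : Fin m × Fin (n + 1) →₀ ℕ}
    (he : ∀ s, coeff s P ≠ 0 → otherPart i₀ i₁ s ≤ e → otherPart i₀ i₁ s = e) :
    coeff e (aeval (substVar i₀ i₁ M) P) =
      translate (fun h => -(M h (i₁ h)) / M h (i₀ h)) (slice i₀ i₁ e P) := by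
  classical
  conv_lhs => rw [P.as_sum]
  rw [map_sum, coeff_sum, slice, map_sum, Finset.sum_filter]
  refine Finset.sum_congr rfl fun s hs => ?_
  let A : Fin m × Fin (n + 1) → MvPolynomial (Fin m × Fin (n + 1)) (MvPolynomial (Fin m) F) :=
    fun p => if p.2 = i₀ p.1 then
      C (X p.1 + C (-(M p.1 (i₁ p.1)) / M p.1 (i₀ p.1))) -
        ∑ i with i ≠ i₀ p.1 ∧ i ≠ i₁ p.1, C (C (M p.1 i / M p.1 (i₀ p.1))) * X (p.1, i)
      else 1
  have hprod : aeval (substVar i₀ i₁ M) (monomial s (coeff s P)) =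
      C (C (coeff s P)) * ((∏ p, A p ^ s p) * monomial (otherPart i₀ i₁ s) 1) := by
    rw [aeval_monomial, Finsupp.prod_fintype _ _ (fun p => pow_zero _)]
    congr 1
    rw [monomial_eq, C_1, one_mul, Finsupp.prod_fintype _ _ (fun p => pow_zero _),
      ← Finset.prod_mul_distrib]
    refine Finset.prod_congr rfl fun p _ => ?_
    rw [substVar, mul_pow]
    congr 1
    rw [otherPart, Finsupp.filter_apply]
    split_ifs <;> simp
  have hA : constantCoeff (∏ p, A p ^ s p) =
      ∏ h, (X h + C (-(M h (i₁ h)) / M h (i₀ h))) ^ s (h, i₀ h) := by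
    rw [map_prod, Fintype.prod_prod_type]
    refine Finset.prod_congr rfl fun h _ => ?_
    rw [Finset.prod_eq_single (i₀ h)]
    · rw [map_pow]
      congr 1
      simp [A]
    · intro i _ hi
      simp [A, hi]
    · simp
  rw [hprod, coeff_C_mul, coeff_mul_monomial']
  by_cases hse : otherPart i₀ i₁ s = e
  · rw [if_pos hse, if_pos hse.le, hse, tsub_self, mul_one, ← constantCoeff_eq, hA,
      translate_monomial, Finsupp.prod_fintype _ _ (fun p => pow_zero _), smul_eq_C_mul]
    rfl
  · rw [if_neg hse, if_neg fun h => hse (he s (mem_support_iff.1 hs) h), mul_zero]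

theorem slice_map {F' : Type*} [Field F'] (φ : F →+* F') (e : Fin m × Fin (n + 1) →₀ ℕ)
    (P : MvPolynomial (Fin m × Fin (n + 1)) F) :
    slice i₀ i₁ e (map φ P) = map φ (slice i₀ i₁ e P) := by
  rw [slice, slice, map_sum, support_map_of_injective _ φ.injective]
  simp only [map_monomial, coeff_map]

/-- For a multihomogeneous polynomial the coefficients of a slice are coefficients of the
polynomial. -/
theorem coeff_slice {d : Fin m → ℕ} {P : MvPolynomial (Fin m × Fin (n + 1)) F}
    (hP : IsMultihomogeneous d P) {e : Fin m × Fin (n + 1) →₀ ℕ}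
    {s : Fin m × Fin (n + 1) →₀ ℕ} (hs : s ∈ P.support) (hse : otherPart i₀ i₁ s = e) :
    coeff (mainPart i₀ s) (slice i₀ i₁ e P) = coeff s P := by
  classical
  rw [slice, coeff_sum, Finset.sum_eq_single s]
  · simp
  · intro r hr hrs
    rw [coeff_monomial, if_neg]
    intro hmain
    apply hrs
    rw [Finset.mem_filter] at hr
    have hm : ∀ h, r (h, i₀ h) = s (h, i₀ h) := fun h => DFunLike.congr_fun hmain h
    have ho : ∀ h i, i ≠ i₀ h → i ≠ i₁ h → r (h, i) = s (h, i) := by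
      intro h i hi0 hi1
      have := DFunLike.congr_fun (hr.2.trans hse.symm) (h, i)
      simpa [otherPart, Finsupp.filter_apply, hi0, hi1] using this
    have hne : ∀ h i, i ≠ i₁ h → r (h, i) = s (h, i) := by
      intro h i hi1
      by_cases hi0 : i = i₀ h
      · rw [hi0]; exact hm h
      · exact ho h i hi0 hi1
    ext ⟨h, i⟩
    -- The exponent of the variable set to `1` is recovered from homogeneity, so distinct monomials
    -- of a slice never merge.
    by_cases hi1 : i = i₁ h
    · subst hi1
      have h1 := (hP r hr.1 h).trans (hP s hs h).symm
      rw [← Finset.add_sum_erase _ _ (Finset.mem_univ (i₁ h)),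
        ← Finset.add_sum_erase _ (fun i => s (h, i)) (Finset.mem_univ (i₁ h)),
        Finset.sum_congr rfl fun i hi => hne h i (Finset.ne_of_mem_erase hi)] at h1
      exact Nat.add_right_cancel h1
    · exact hne h i hi1
  · intro h
    exact absurd (Finset.mem_filter.2 ⟨hs, hse⟩) h

theorem exists_of_coeff_slice_ne_zero {P : MvPolynomial (Fin m × Fin (n + 1)) F}
    {e : Fin m × Fin (n + 1) →₀ ℕ} {r : Fin m →₀ ℕ} (hr : coeff r (slice i₀ i₁ e P) ≠ 0) :
    ∃ s ∈ P.support, otherPart i₀ i₁ s = e ∧ mainPart i₀ s = r := by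
  classical
  rw [slice, coeff_sum] at hr
  obtain ⟨s, hs, hne⟩ := Finset.exists_ne_zero_of_sum_ne_zero hr
  rw [Finset.mem_filter] at hs
  refine ⟨s, hs.1, hs.2, ?_⟩
  rw [coeff_monomial] at hne
  by_contra h
  exact hne (if_neg h)

end Reduction

end GenRoth

/-- Generalized Roth lemma. The coefficients of `P` and of the linear forms `M j` lie in a number
field `K`, embedded by `φ` in the algebraic closure of `ℚ`, over which the index is taken. -/
theorem mainTheorem6 {K : Type*} [Field K] [NumberField K] (φ : K →+* AlgebraicClosure ℚ)
    (m n : ℕ) (hm : 1 ≤ m) (hn : 1 ≤ n)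
    (d : Fin m → ℕ) (hd : ∀ j, 0 < d j)
    (P : MvPolynomial (Fin m × Fin (n + 1)) K) (hP0 : P ≠ 0)
    (hP : GenRoth.IsMultihomogeneous d P)
    (M : Fin m → Fin (n + 1) → K) (hM : ∀ j, M j ≠ 0)
    (σ : ℝ) (hσ0 : 0 < σ) (hσ : σ ≤ 1 / 2)
    (hdσ : ∀ (j : ℕ) (hj : j + 1 < m),
      (d ⟨j + 1, hj⟩ : ℝ) / (d ⟨j, Nat.lt_of_succ_lt hj⟩ : ℝ) ≤ σ)
    (hheight : ∀ j : Fin m,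
      (n : ℝ) * σ⁻¹ * (GenRoth.polyHeight P + 4 * (m : ℝ) * (d ⟨0, hm⟩ : ℝ)) ≤
        (d j : ℝ) * GenRoth.absHeight (M j)) :
    GenRoth.index d (fun j i => φ (M j i)) (MvPolynomial.map φ P) ≤
      ((2 * (m : ℝ) * σ ^ ((1 : ℝ) / (2 : ℝ) ^ (m - 1)) : ℝ) : EReal) := by
  classical
  obtain ⟨k, rfl⟩ : ∃ k, m = k + 1 := ⟨m - 1, by omega⟩
  choose i₀ i₁ h01 hi₀ hratio using fun j => GenRoth.exists_ratio_height hn (hM j)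
  refine sSup_le ?_
  rintro y ⟨t, ht0, htP, rfl⟩
  rw [EReal.coe_le_coe_iff]
  -- Minimality of `e` keeps monomials of `P` with a smaller other part from contributing to the
  -- coefficient at `e`.
  obtain ⟨e, heP, hemin⟩ := Finset.exists_minimal
    ((MvPolynomial.support_nonempty.2 hP0).image (GenRoth.otherPart i₀ i₁))
  obtain ⟨s, hs, rfl⟩ := Finset.mem_image.1 heP
  set e := GenRoth.otherPart i₀ i₁ s with he
  set f := GenRoth.slice i₀ i₁ e P with hf
  set ξ : Fin (k + 1) → K := fun h => -(M h (i₁ h)) / M h (i₀ h) with hξ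
  have htf : GenRoth.translate ξ f ∈ GenRoth.orderIdeal d t := by
    have h1 := GenRoth.aeval_substVar_mem h01
      (M := fun j i => φ (M j i)) (fun h => by simpa using hi₀ h) htP
    have h2 := MvPolynomial.mem_map_C_iff.1 h1 e
    rw [GenRoth.coeff_aeval_substVar, GenRoth.slice_map] at h2
    · have h3 : (fun h => -(φ (M h (i₁ h))) / φ (M h (i₀ h))) = fun h => φ (ξ h) := by
        funext h
        simp [hξ]
      rw [h3, ← GenRoth.map_translate] at h2
      intro r hr
      refine h2 r ?_
      rw [MvPolynomial.coeff_map]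
      simpa using hr
    · intro r hr hre
      rw [MvPolynomial.coeff_map] at hr
      have hr' : MvPolynomial.coeff r P ≠ 0 := fun h => hr (by rw [h, map_zero])
      exact le_antisymm hre (hemin (Finset.mem_image_of_mem _
        (MvPolynomial.mem_support_iff.2 hr')) hre)
  have hf0 : f ≠ 0 := by
    intro h
    have h1 := GenRoth.coeff_slice hP hs he.symm
    rw [← hf, h, MvPolynomial.coeff_zero] at h1
    exact MvPolynomial.mem_support_iff.1 hs h1.symm
  have hfP : GenRoth.polyHeight f ≤ GenRoth.polyHeight P := by
    have hex : ∀ r : Fin (k + 1) →₀ ℕ, ∃ s', MvPolynomial.coeff r f ≠ 0 →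
        MvPolynomial.coeff r f = MvPolynomial.coeff s' P := by
      intro r
      by_cases hr : MvPolynomial.coeff r f = 0
      · exact ⟨0, fun h => absurd hr h⟩
      · obtain ⟨s', hs', hse', rfl⟩ := GenRoth.exists_of_coeff_slice_ne_zero hr
        exact ⟨s', fun _ => GenRoth.coeff_slice hP hs' hse'⟩
    choose g hg using hex
    exact GenRoth.polyHeight_le_of_coeff g hg
  let d' : ℕ → ℕ := fun i => if h : i < k + 1 then d ⟨i, h⟩ else 1
  have hd'eq : ∀ i : Fin (k + 1), d' i = d i := fun i => dif_pos i.2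
  have hd'0 : d' 0 = d ⟨0, hm⟩ := dif_pos (Nat.succ_pos k)
  have hd'pos : ∀ i, 0 < d' i := by
    intro i
    simp only [d']
    split_ifs
    · exact hd _
    · exact one_pos
  have hfdeg : GenRoth.DegLE (GenRoth.truncDeg d' (k + 1)) f := by
    intro r hr i
    obtain ⟨s', hs', -, rfl⟩ := GenRoth.exists_of_coeff_slice_ne_zero hr
    rw [GenRoth.truncDeg, if_pos i.2, hd'eq, ← hP s' hs' i]
    exact Finset.single_le_sum (f := fun j => s' (i, j)) (fun _ _ => Nat.zero_le _)
      (Finset.mem_univ (i₀ i))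
  have hd'fun : (fun i : Fin (k + 1) => d' i) = d := funext hd'eq
  have hn' : (0 : ℝ) < n := by exact_mod_cast hn
  have hmain := GenRoth.roth_lemma hσ0 hσ ξ k le_rfl d' hd'pos ?_ hf0 hfdeg ?_
    (t := t) (by rw [hd'fun]; exact htf)
  · simpa using hmain
  · intro j hj
    have h1 := hdσ j hj
    have h2 : d' (j + 1) = d ⟨j + 1, hj⟩ := dif_pos hj
    have h3 : d' j = d ⟨j, Nat.lt_of_succ_lt hj⟩ := dif_pos (Nat.lt_of_succ_lt hj)
    rw [h2, h3]
    exact (div_le_iff₀ (by exact_mod_cast hd _)).1 h1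
  · intro j _
    have h1 := hheight j
    rw [hd'eq, hd'0]
    have h2 : (d j : ℝ) * GenRoth.absHeight (M j) ≤
        d j * (n * GenRoth.absHeight ![ξ j, 1]) := by
      gcongr
      exact hratio j
    -- The factor `n` in the height hypothesis pays for passing from `M j` to the single ratio `ξ
    -- j`.
    have h3 : (n : ℝ) * (σ⁻¹ * (GenRoth.polyHeight P + 4 * (k + 1) * d ⟨0, hm⟩)) ≤
        n * (d j * GenRoth.absHeight ![ξ j, 1]) := by
      push_cast at h1
      linarith
    refine le_trans ?_ (le_of_mul_le_mul_left h3 hn')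
    gcongr
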